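/- Let $\mathbf k$ be a field of characteristic $0$. **Conventions.** For $\mathbf k[\partial]$-modules $U,V,W$, a *conformal bilinear map* $f_\lambda:U\times V\to W[\lambda]$ is a $\mathbf k$-bilinear map with $f_\lambda(\partial u,v)=-\lambda f_\lambda(u,v)$ and $f_\lambda(u,\partial v)=(\lambda+\partial)f_\lambda(u,v)$. If $f_\lambda(u,v)=\sum_n\lambda^n w_n$, then $f_{-\lambda-\partial}(u,v)=\sum_n(-\lambda-\partial)^nw_n$, and similarly for $f_{-\lambda-\mu-\partial}$ and the like. A *Leibniz conformal algebra* is a $\mathbf k[\partial]$-module $Q$ with a conformal bilinear map $[\cdot_\lambda\cdot]:Q\times Q\to Q[\lambda]$ such that $[a_\lambda[b_\mu c]]=[[a_\lambda b]_{\lambda+\mu}c]+[b_\mu[a_\lambda c]]$; it is *finite* if $Q$ is finitely generated over $\mathbf k[\partial]$. A *representation* $(M,l,r)$ of $Q$ is a $\mathbf k[\partial]$-module $M$ with conformal bilinear maps $(a,v)\mapsto l(a)_\lambda v,\ r(a)_\lambda v$ from $Q\times M$ to $M[\lambda]$ such that $$l(a)_\lambda(l(b)_\mu v)=l([a_\lambda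 b])_{\lambda+\mu}v+l(b)_\mu(l(a)_\lambda v),$$ $$l(a)_\lambda(r(b)_{-\mu-\partial}v)=r(b)_{-\lambda-\mu-\partial}(l(a)_\lambda v)+r([a_\lambda b])_{-\mu-\partial}v,$$ $$r(b)_{-\lambda-\mu-\partial}(r(a)_{-\mu-\partial}v)=-r(b)_{-\lambda-\mu-\partial}(l(a)_\lambda v).$$ **Matched pairs.** Let $Q_1,Q_2$ be Leibniz conformal algebras. $(Q_1,Q_2;(l,r),(\phi,\psi))$ is a *matched pair* if $(Q_2,l,r)$ is a representation of $Q_1$, $(Q_1,\phi,\psi)$ is a representation of $Q_2$, and for all $a,b\in Q_1$, $x,y\in Q_2$: $$[x_\lambda(r(a)_{-\mu-\partial}y)]+r(\phi(y)_\mu a)_{-\lambda-\partial}x=r(a)_{-\lambda-\mu-\partial}([x_\lambda y])+[y_\mu(r(a)_{-\lambda-\partial}x)]+r(\phi(x)_\lambda a)_{-\mu-\partial}y,$$ $$l(a)_\lambda([x_\mu y])=[(l(a)_\lambda x)_{\lambda+\mu}y]+l(\psi(x)_{-\lambda-\partial}a)_{\lambda+\mu}y+[x_\mu(l(a)_\lambda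 y)]+r(\psi(y)_{-\lambda-\partial}a)_{-\mu-\partial}x,$$ $$[x_\lambda(l(a)_\mu y)]+r(\psi(y)_{-\mu-\partial}a)_{-\lambda-\partial}x=l(\phi(x)_\lambda a)_{\lambda+\mu}y+l(a)_\mu([x_\lambda y])+[(r(a)_{-\lambda-\partial}x)_{\lambda+\mu}y],$$ $$[a_\lambda(\psi(x)_{-\mu-\partial}b)]+\psi(l(b)_\mu x)_{-\lambda-\partial}a=\psi(x)_{-\lambda-\mu-\partial}[a_\lambda b]+[b_\mu(\psi(x)_{-\lambda-\partial}a)]+\psi(l(a)_\lambda x)_{-\mu-\partial}b,$$ $$[a_\lambda(\phi(x)_\mu b)]+\psi(r(b)_{-\mu-\partial}x)_{-\lambda-\partial}a=[(\psi(x)_{-\lambda-\partial}a)_{\lambda+\mu}b]+\phi(l(a)_\lambda x)_{\lambda+\mu}b+\phi(x)_\mu([a_\lambda b]),$$ $$[(\phi(x)_\lambda a)_{\lambda+\mu}b]+\phi(r(a)_{-\lambda-\partial}x)_{\lambda+\mu}b+[(\psi(x)_{-\mu-\partial}a)_{\lambda+\mu}b]+\phi(l(a)_\mu x)_{\lambda+\mu}b=0.$$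 **Duals.** The *conformal dual* $U^{*c}$ consists of the $\mathbf k$-linear maps $f_\lambda:U\to\mathbf k[\lambda]$ with $f_\lambda(\partial u)=\lambda f_\lambda(u)$; it is a $\mathbf k[\partial]$-module by $(\partial f)_\lambda=-\lambda f_\lambda$. Write $\langle f,u\rangle_\lambda=f_\lambda(u)$. For a bracket on $Q$ let $L(a)_\lambda b=[a_\lambda b]$ and $R(a)_\lambda b=[b_{-\lambda-\partial}a]$. If $M$ is finitely generated over $\mathbf k[\partial]$ and $l$ is a conformal bilinear map $Q\times M\to M[\lambda]$, let $l^*$ be the conformal bilinear map $Q\times M^{*c}\to M^{*c}[\lambda]$ with $\langle l^*(a)_\lambda f,v\rangle_\mu=-\langle f,l(a)_\lambda v\rangle_{\mu-\lambda}$. For a bracket on $Q^{*c}$, with $Q$ finitely generated and free, let $\mathcal L,\mathcal R$ be the maps $L,R$ of $Q^{*c}$, and regard $\mathcal L^*,\mathcal R^*$ as acting on $Q$, through the isomorphism $Q\cong(Q^{*c})^{*c}$ sending $a$ to $f\mapsto\langle f,a\rangle_{-\lambda}$. **Conformal Manin triples.** A *conformal Manin triple* $(E,E_0,E_1)$ consists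 of a finite Leibniz conformal algebra $E$, finite Leibniz conformal subalgebras $E_0,E_1$ with $E=E_0\oplus E_1$ as $\mathbf k[\partial]$-modules, and a $\mathbf k$-bilinear form $B_\lambda:E\times E\to\mathbf k[\lambda]$ with $B_\lambda(\partial u,v)=-\lambda B_\lambda(u,v)$ and $B_\lambda(u,\partial v)=\lambda B_\lambda(u,v)$ which is skew-symmetric, $B_\lambda(u,v)=-B_{-\lambda}(v,u)$, non-degenerate, i.e. $v\mapsto B_\lambda(v,\cdot)$ is an isomorphism $E\to E^{*c}$, and invariant, $B_\mu(a,[b_\lambda c])=B_{-\lambda}([a_\mu c]+[c_{-\mu-\partial}a],b)$, and such that $B_\lambda(E_0,E_0)=B_\lambda(E_1,E_1)=0$. **Bialgebras.** Let $\partial$ act on $Q\otimes Q$ (tensor product over $\mathbf k$) by $\partial^{\otimes2}=\partial\otimes\mathrm{id}+\mathrm{id}\otimes\partial$, let $\tau$ be the flip of $Q\otimes Q$ and $\tau_{12}=\tau\otimes\mathrm{id}$. A *Leibniz conformal coalgebra* is a $\mathbf k[\partial]$-module $Q$ with a $\mathbf k[\partial]$-homomorphism $\Delta:Q\to Q\otimes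 Q$ such that $(\mathrm{id}\otimes\Delta)\Delta=(\Delta\otimes\mathrm{id})\Delta+\tau_{12}(\mathrm{id}\otimes\Delta)\Delta$. A *Leibniz conformal bialgebra* is a triple $(Q,[\cdot_\lambda\cdot],\Delta)$ such that $(Q,[\cdot_\lambda\cdot])$ is a Leibniz conformal algebra, $(Q,\Delta)$ is a Leibniz conformal coalgebra, and for all $a,b\in Q$ $$(R(a)_{\lambda-\partial\otimes\mathrm{id}}\otimes\mathrm{id})\Delta(b)=\tau\big((R(b)_{-\lambda-\partial\otimes\mathrm{id}}\otimes\mathrm{id})\Delta(a)\big),$$ $$\Delta([a_\lambda b])=(\mathrm{id}\otimes R(b)_{-\lambda-\partial^{\otimes2}}-L(b)_{-\lambda-\partial^{\otimes2}}\otimes\mathrm{id}-R(b)_{-\lambda-\partial^{\otimes2}}\otimes\mathrm{id})(\tau+\mathrm{id})\Delta(a)+(\mathrm{id}\otimes L(a)_\lambda+L(a)_\lambda\otimes\mathrm{id})\Delta(b).$$ Here, for $F_\lambda(u)=\sum_n\lambda^nF_n(u)$ and an operator $T$ on $Q\otimes Q$, $F_T\otimes\mathrm{id}$ is $u\otimes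 v\mapsto\sum_nT^n(F_n(u)\otimes v)$, and $\mathrm{id}\otimes F_T$ is $u\otimes v\mapsto\sum_nT^n(u\otimes F_n(v))$. **Statement.** Let $(Q,[\cdot_\lambda\cdot])$ be a finite Leibniz conformal algebra which is free as a $\mathbf k[\partial]$-module, and let $\Delta:Q\to Q\otimes Q$ be a homomorphism of $\mathbf k[\partial]$-modules. Suppose that the bracket on $Q^{*c}$ obtained from $\Delta$, i.e. the one given by $\langle[f_\lambda g],a\rangle_\mu=\langle f\otimes g,\Delta(a)\rangle_{\lambda,\mu-\lambda}$, where $\langle f\otimes g,a\otimes b\rangle_{\lambda,\mu}=\langle f,a\rangle_\lambda\langle g,b\rangle_\mu$, makes $Q^{*c}$ a Leibniz conformal algebra. Then the following conditions are equivalent: (a) $(Q,Q^{*c};(L^*,-L^*-R^*),(\mathcal L^*,-\mathcal L^*-\mathcal R^*))$ is a matched pair of Leibniz conformal algebras; (b) there is a $\lambda$-bracket on the $\mathbf k[\partial]$-module $Q\oplus Q^{*c}$ that restricts to the given brackets of $Q$ and of $Q^{*c}$, and for which $(Q\oplus Q^{*c},Q,Q^{*c})$ is a conformal Manin triple with the form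 $$B_\lambda(a+f,b+g)=\langle f,b\rangle_\lambda-\langle g,a\rangle_{-\lambda}\qquad(a,b\in Q,\ f,g\in Q^{*c});$$ (c) $(Q,[\cdot_\lambda\cdot],\Delta)$ is a Leibniz conformal bialgebra. -/

import Mathlib

open Polynomial TensorProduct

set_option linter.unusedSectionVars false

noncomputable section

namespace LeibnizConformal

/-! Throughout, `k` is a field, a `k[∂]`-module is a module over the polynomial ring `k[X]`
(with a compatible `k`-vector space structure), `∂` being the action of `X`.  For a vector space
`V`, the space `V[λ]` is `PolynomialModule k V`; there `X •` is multiplication by `λ`. -/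

section Polynomials

variable (k : Type*) [Field k]
variable (V : Type*) [AddCommGroup V] [Module k V] [Module k[X] V] [IsScalarTower k k[X] V]

/-- The operator `∂` on a `k[∂]`-module. -/
def der : Module.End k V := Algebra.lsmul k k V (X : k[X])

/-- The operator `∂` acting coefficientwise on `V[λ]`. -/
def polyDer : Module.End k (PolynomialModule k V) := PolynomialModule.map k (der k V)

/-- Multiplication by `λ` on `V[λ]`. -/
def polyVar : Module.End k (PolynomialModule k V) :=
  Algebra.lsmul k k (PolynomialModule k V) (X : k[X])

variable {k V}

/-- Substitution of a linear operator `t` for `λ`:  `∑ λⁿ vₙ ↦ ∑ tⁿ vₙ`. -/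
def substEnd {W : Type*} [AddCommGroup W] [Module k W] (t : Module.End k W) :
    PolynomialModule k W →ₗ[k] W :=
  (Finsupp.lsum k fun n => t ^ n) ∘ₗ (PolynomialModule.coeffLinearEquiv k k).toLinearMap

variable (k V)

/-- The substitution `p(λ) ↦ p(-λ-∂)`, from `V[λ]` to `V[λ]`. -/
def reflect : PolynomialModule k V →ₗ[k] PolynomialModule k V :=
  (Finsupp.lsum k fun n =>
    ((-polyVar k V - polyDer k V) ^ n) ∘ₗ PolynomialModule.lsingle k 0) ∘ₗ
    (PolynomialModule.coeffLinearEquiv k k).toLinearMap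

variable {k V}

@[simp] theorem der_apply (v : V) : der k V v = (X : k[X]) • v := rfl

@[simp] theorem polyVar_apply (p : PolynomialModule k V) : polyVar k V p = (X : k[X]) • p := rfl

theorem polyDer_single (n : ℕ) (v : V) :
    polyDer k V (PolynomialModule.single k n v) = PolynomialModule.single k n ((X : k[X]) • v) := by
  simp [polyDer]

theorem reflect_single (n : ℕ) (v : V) :
    reflect k V (PolynomialModule.single k n v) =
      ((-polyVar k V - polyDer k V) ^ n) (PolynomialModule.single k 0 v) := by
  simp only [reflect, LinearMap.comp_apply, LinearEquiv.coe_coe,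
    PolynomialModule.coeffLinearEquiv_apply, PolynomialModule.coeff_single, Finsupp.lsum_single]
  rfl

theorem commute_polyVar_polyDer : Commute (polyVar k V) (polyDer k V) := by
  refine LinearMap.ext fun p => ?_
  induction p using PolynomialModule.induction_linear with
  | zero => simp
  | add p q hp hq => rw [map_add, map_add, hp, hq]
  | single n v =>
    simp only [Module.End.mul_apply, polyVar_apply, polyDer_single, ← monomial_one_one_eq_X,
      PolynomialModule.monomial_smul_single]
    simp

theorem reflect_var (p : PolynomialModule k V) :
    reflect k V ((X : k[X]) • p) = -((X : k[X]) • reflect k V p) - polyDer k V (reflect k V p) := by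
  induction p using PolynomialModule.induction_linear with
  | zero => simp
  | add p q hp hq => rw [smul_add, map_add, map_add, hp, hq, smul_add, map_add]; abel
  | single n v =>
    rw [← monomial_one_one_eq_X, PolynomialModule.monomial_smul_single, reflect_single,
      reflect_single, add_comm, pow_succ', monomial_one_one_eq_X]
    simp

theorem reflect_der (p : PolynomialModule k V) :
    reflect k V (polyDer k V p) = polyDer k V (reflect k V p) := by
  induction p using PolynomialModule.induction_linear with
  | zero => simp
  | add p q hp hq => rw [map_add, map_add, hp, hq, map_add, map_add]
  | single n v =>
    rw [polyDer_single, reflect_single, reflect_single, ← polyDer_single]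
    have h : Commute ((-polyVar k V - polyDer k V) ^ n) (polyDer k V) :=
      ((commute_polyVar_polyDer (k := k) (V := V)).neg_left.sub_left (Commute.refl _)).pow_left n
    exact LinearMap.congr_fun h.eq _

end Polynomials

section ConformalMaps

variable (k : Type*) [Field k]
variable (U : Type*) [AddCommGroup U] [Module k U] [Module k[X] U] [IsScalarTower k k[X] U]
variable (V : Type*) [AddCommGroup V] [Module k V] [Module k[X] V] [IsScalarTower k k[X] V]
variable (W : Type*) [AddCommGroup W] [Module k W] [Module k[X] W] [IsScalarTower k k[X] W]

/-- The space of conformal bilinear maps from `U × V` to `W`: the `k`-bilinear maps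
`f_λ : U × V → W[λ]` with `f_λ(∂u, v) = -λ f_λ(u, v)` and `f_λ(u, ∂v) = (λ + ∂) f_λ(u, v)`.
A conformal bilinear map from `Q × M` to `M` is the same thing, by currying, as a
`k[∂]`-module homomorphism `Q → Cend(M)`. -/
def conformalBilin : Submodule k (U →ₗ[k] V →ₗ[k] PolynomialModule k W) where
  carrier := {f | (∀ u v, f ((X : k[X]) • u) v = -((X : k[X]) • f u v)) ∧
    ∀ u v, f u ((X : k[X]) • v) = (X : k[X]) • f u v + polyDer k W (f u v)}
  add_mem' := by
    rintro f g ⟨hf, hf'⟩ ⟨hg, hg'⟩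
    refine ⟨fun u v => ?_, fun u v => ?_⟩
    · simp only [LinearMap.add_apply, hf, hg, smul_add, neg_add]
    · simp only [LinearMap.add_apply, hf', hg', smul_add, map_add]; abel
  zero_mem' := by constructor <;> simp
  smul_mem' := by
    rintro c f ⟨hf, hf'⟩
    refine ⟨fun u v => ?_, fun u v => ?_⟩
    · simp only [LinearMap.smul_apply, hf, smul_neg, smul_comm c]
    · simp only [LinearMap.smul_apply, hf', smul_add, map_smul, smul_comm c (X : k[X])]

/-- Conformal bilinear maps from `U × V` to `W`. -/
abbrev ConformalBilin : Type _ := ↥(conformalBilin k U V W)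

variable {k U V W}

/-- The value `f_c(u, v) ∈ W` of a conformal bilinear map at `λ = c`.  In characteristic zero `k` is
infinite, so that an identity between polynomials in `λ, μ, …` with coefficients in a vector space
is the same as the identity between all their values at scalars; the identities below are
written in this way. -/
def ev (f : ConformalBilin k U V W) (c : k) (u : U) (v : V) : W :=
  PolynomialModule.eval c (f.1 u v)

/-- The value `f_{c-∂}(u, v) ∈ W`: if `f_λ(u, v) = ∑ λⁿ wₙ` this is `∑ (c - ∂)ⁿ wₙ`. -/
def evD (f : ConformalBilin k U V W) (c : k) (u : U) (v : V) : W :=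
  substEnd (c • (1 : Module.End k W) - der k W) (f.1 u v)

end ConformalMaps

section Dual

variable (k : Type*) [Field k]
variable (U : Type*) [AddCommGroup U] [Module k U] [Module k[X] U] [IsScalarTower k k[X] U]

/-- The `k`-linear maps `f_λ : U → k[λ]` with `f_λ(∂u) = λ f_λ(u)`. -/
def conformalDual : Submodule k (U →ₗ[k] k[X]) where
  carrier := {f | ∀ u, f ((X : k[X]) • u) = X * f u}
  add_mem' := by
    intro f g hf hg u
    simp only [LinearMap.add_apply, hf u, hg u, mul_add]
  zero_mem' := by intro u; simp
  smul_mem' := by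
    intro c f hf u
    simp only [LinearMap.smul_apply, hf u, mul_smul_comm]

/-- The conformal dual `U^{*c}` of a `k[∂]`-module `U`. -/
def ConformalDual : Type _ := ↥(conformalDual k U)

instance : AddCommGroup (ConformalDual k U) := inferInstanceAs (AddCommGroup ↥(conformalDual k U))

instance : Module k (ConformalDual k U) := inferInstanceAs (Module k ↥(conformalDual k U))

/-- The pairing `⟨f, u⟩_λ = f_λ(u) ∈ k[λ]` of `U^{*c}` and `U`. -/
def pairing : ConformalDual k U →ₗ[k] U →ₗ[k] k[X] := (conformalDual k U).subtype

variable {k U}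

theorem pairing_X_smul_right (f : ConformalDual k U) (u : U) :
    pairing k U f ((X : k[X]) • u) = X * pairing k U f u := f.2 u

/-- Constructor for elements of the conformal dual. -/
def mkDual (f : U →ₗ[k] k[X]) (hf : ∀ u, f ((X : k[X]) • u) = X * f u) : ConformalDual k U :=
  ⟨f, hf⟩

@[simp] theorem pairing_mkDual (f : U →ₗ[k] k[X]) (hf : ∀ u, f ((X : k[X]) • u) = X * f u) :
    pairing k U (mkDual f hf) = f := rfl

theorem dual_ext {f g : ConformalDual k U} (h : ∀ u, pairing k U f u = pairing k U g u) : f = g :=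
  Subtype.ext (LinearMap.ext h)

variable (k U)

/-- The operator `∂` on `U^{*c}`:  `(∂f)_λ = -λ f_λ`. -/
def dualDer : Module.End k (ConformalDual k U) :=
  LinearMap.restrict (p := conformalDual k U) (q := conformalDual k U)
    (-LinearMap.compRight k (M := U) (LinearMap.mulLeft k (X : k[X]))) fun f hf u => by
      simp only [LinearMap.neg_apply, LinearMap.compRight_apply, LinearMap.comp_apply,
        LinearMap.mulLeft_apply, hf u, mul_neg]

/-- The `k[∂]`-module structure of the conformal dual. -/
instance : Module k[X] (ConformalDual k U) :=
  Module.compHom _ (aeval (dualDer k U)).toRingHom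

variable {k U}

theorem dual_smul_def (p : k[X]) (f : ConformalDual k U) : p • f = aeval (dualDer k U) p f := rfl

instance : IsScalarTower k k[X] (ConformalDual k U) :=
  ⟨fun c p f => by simp [dual_smul_def]⟩

theorem pairing_X_smul_left (f : ConformalDual k U) (u : U) :
    pairing k U ((X : k[X]) • f) u = -(X * pairing k U f u) := by
  rw [dual_smul_def, aeval_X]; rfl

theorem pairing_smul_left (p : k[X]) (f : ConformalDual k U) (u : U) :
    pairing k U (p • f) u = p.comp (-X) * pairing k U f u := by
  induction p using Polynomial.induction_on' generalizing f with
  | add p q hp hq => simp only [add_smul, map_add, LinearMap.add_apply, hp, hq, add_comp, add_mul]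
  | monomial n c =>
    rw [← C_mul_X_pow_eq_monomial]
    induction n generalizing f with
    | zero => simp [← smul_eq_C_mul, dual_smul_def, ← algebraMap_eq]
    | succ n ih =>
      rw [pow_succ, ← mul_assoc, mul_smul, ih, pairing_X_smul_left]
      simp only [mul_comp, C_comp, X_comp, pow_comp]
      ring

theorem pairing_smul_right (p : k[X]) (f : ConformalDual k U) (u : U) :
    pairing k U f (p • u) = p * pairing k U f u := by
  induction p using Polynomial.induction_on' generalizing u with
  | add p q hp hq => simp only [add_smul, map_add, hp, hq, add_mul]
  | monomial n c =>
    rw [← C_mul_X_pow_eq_monomial]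
    induction n generalizing u with
    | zero =>
      rw [pow_zero, mul_one, ← smul_eq_C_mul, ← algebraMap_eq, algebraMap_smul, map_smul]
    | succ n ih =>
      rw [pow_succ, ← mul_assoc, mul_smul, ih, pairing_X_smul_right]
      ring

variable (k U)

/-- The canonical map `U → (U^{*c})^{*c}`, `a ↦ (f ↦ ⟨f, a⟩_{-λ})`. -/
def doubleDual : U →ₗ[k[X]] ConformalDual k (ConformalDual k U) where
  toFun a := mkDual ((aeval (-X : k[X])).toLinearMap ∘ₗ (pairing k U).flip a) fun f => by
    simp only [LinearMap.comp_apply, LinearMap.flip_apply, pairing_X_smul_left]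
    simp
  map_add' a b := dual_ext fun f => by
    simp only [map_add, LinearMap.add_apply, pairing_mkDual, LinearMap.comp_apply,
      LinearMap.flip_apply]
  map_smul' p a := dual_ext fun f => by
    rw [RingHom.id_apply, pairing_smul_left, pairing_mkDual, pairing_mkDual]
    simp only [LinearMap.comp_apply, LinearMap.flip_apply, pairing_smul_right,
      AlgHom.toLinearMap_apply, map_mul]
    rfl

variable {k U}

theorem pairing_doubleDual (a : U) (f : ConformalDual k U) :
    pairing k (ConformalDual k U) (doubleDual k U a) f = (pairing k U f a).comp (-X) := rfl

/-- A `k[∂]`-linear map to `k[∂]`, read as an element of the conformal dual. -/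
def ofLinear (f : U →ₗ[k[X]] k[X]) : ConformalDual k U :=
  mkDual (f.restrictScalars k) fun u => by simp

theorem pairing_ofLinear (f : U →ₗ[k[X]] k[X]) (u : U) : pairing k U (ofLinear f) u = f u := rfl

theorem comp_neg_comp_neg (p : k[X]) : (p.comp (-X)).comp (-X) = p := by
  simp [comp_assoc]

theorem dual_expand {ι : Type*} [Fintype ι] (b : Module.Basis ι k[X] U) (f : ConformalDual k U) :
    f = ∑ i, (pairing k U f (b i)).comp (-X) • ofLinear (b.coord i) := by
  refine dual_ext fun u => ?_
  conv_lhs => rw [← b.sum_repr u]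
  simp only [map_sum, LinearMap.sum_apply, pairing_smul_left, pairing_smul_right,
    comp_neg_comp_neg, pairing_ofLinear, Module.Basis.coord_apply]
  exact Finset.sum_congr rfl fun i _ => mul_comm _ _

instance [Module.Finite k[X] U] [Module.Free k[X] U] : Module.Finite k[X] (ConformalDual k U) := by
  let b := Module.Free.chooseBasis k[X] U
  refine Module.Finite.of_surjective
    (Fintype.linearCombination k[X] fun i => (ofLinear (b.coord i) : ConformalDual k U)) fun f => ?_
  exact ⟨fun i => (pairing k U f (b i)).comp (-X), (dual_expand b f).symm⟩

theorem doubleDual_bijective [Module.Finite k[X] U] [Module.Free k[X] U] :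
    Function.Bijective (doubleDual k U) := by
  let b := Module.Free.chooseBasis k[X] U
  constructor
  · rw [injective_iff_map_eq_zero]
    intro a ha
    refine b.ext_elem fun i => ?_
    have h : pairing k _ (doubleDual k U a) (ofLinear (b.coord i)) = 0 := by rw [ha]; simp
    rw [pairing_doubleDual, pairing_ofLinear] at h
    have h' := congrArg (fun p : k[X] => p.comp (-X)) h
    simpa [comp_neg_comp_neg] using h'
  · intro F
    refine ⟨∑ i, (pairing k _ F (ofLinear (b.coord i))).comp (-X) • b i, dual_ext fun f => ?_⟩
    conv_rhs => rw [dual_expand b f]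
    simp only [map_sum, LinearMap.sum_apply, map_smul, pairing_smul_left, pairing_smul_right,
      comp_neg_comp_neg, pairing_doubleDual]
    exact Finset.sum_congr rfl fun i _ => mul_comm _ _

variable (k U)

/-- The identification of `U` with its double conformal dual, for `U` finite and free. -/
def doubleDualEquiv [Module.Finite k[X] U] [Module.Free k[X] U] :
    U ≃ₗ[k[X]] ConformalDual k (ConformalDual k U) :=
  LinearEquiv.ofBijective (doubleDual k U) doubleDual_bijective

end Dual

section DualPolynomials

variable (k : Type*) [Field k]
variable (U : Type*) [AddCommGroup U] [Module k U] [Module k[X] U] [IsScalarTower k k[X] U]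

/-- The `k`-linear maps `G : U → k[μ][λ]` with `G(∂u) = μ G(u)`.  Here `μ` is `C X` and `λ` is `X`
in `k[X][X]`. -/
def dualFamily : Submodule k (U →ₗ[k] k[X][X]) where
  carrier := {G | ∀ u, G ((X : k[X]) • u) = C X * G u}
  add_mem' := by
    intro f g hf hg u
    simp only [LinearMap.add_apply, hf u, hg u, mul_add]
  zero_mem' := by intro u; simp
  smul_mem' := by
    intro c f hf u
    simp only [LinearMap.smul_apply, hf u, mul_smul_comm]

variable {k U}

theorem dualFamily_smul (G : ↥(dualFamily k U)) (p : k[X]) (u : U) :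
    G.1 (p • u) = C p * G.1 u := by
  induction p using Polynomial.induction_on' generalizing u with
  | add p q hp hq => simp only [add_smul, map_add, hp, hq, add_mul]
  | monomial n c =>
    rw [← C_mul_X_pow_eq_monomial]
    induction n generalizing u with
    | zero =>
      rw [pow_zero, mul_one, ← smul_eq_C_mul, ← algebraMap_eq, algebraMap_smul, map_smul,
        algebraMap_smul]
    | succ n ih =>
      rw [pow_succ, ← mul_assoc, mul_smul, ih, G.2 u]
      simp only [C_mul]
      ring

/-- The coefficient of `λⁿ` in a map `U → k[μ][λ]`, an element of `U^{*c}`. -/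
def familyCoeff (n : ℕ) : ↥(dualFamily k U) →ₗ[k] ConformalDual k U where
  toFun G := mkDual ((lcoeff k[X] n).restrictScalars k ∘ₗ G.1) fun u => by
    simp [G.2 u]
  map_add' G H := dual_ext fun u => coeff_add (G.1 u) (H.1 u) n
  map_smul' c G := dual_ext fun u => coeff_smul c (G.1 u) n

theorem pairing_familyCoeff (n : ℕ) (G : ↥(dualFamily k U)) (u : U) :
    pairing k U (familyCoeff n G) u = (G.1 u).coeff n := rfl

theorem familyCoeff_finite [Module.Finite k[X] U] (G : ↥(dualFamily k U)) :
    (Function.support fun n => familyCoeff n G).Finite := by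
  obtain ⟨S, hS⟩ := (Module.Finite.fg_top : (⊤ : Submodule k[X] U).FG)
  refine (Set.finite_Iic (S.sup fun s => (G.1 s).natDegree)).subset fun n hn => ?_
  by_contra hlt
  refine hn (dual_ext fun u => ?_)
  have hu : u ∈ Submodule.span k[X] (S : Set U) := hS ▸ Submodule.mem_top
  have hz : pairing k U (0 : ConformalDual k U) u = 0 := by simp
  rw [pairing_familyCoeff, hz]
  induction hu using Submodule.span_induction with
  | mem x hx =>
    refine coeff_eq_zero_of_natDegree_lt ?_
    exact lt_of_le_of_lt (Finset.le_sup (f := fun s => (G.1 s).natDegree) hx) (not_le.mp hlt)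
  | zero => simp
  | add x y _ _ hx hy => simp [hx, hy]
  | smul p x _ hx => rw [dualFamily_smul, coeff_C_mul, hx (by simp), mul_zero]

/-- For `U` finite, a map `G : U → k[μ][λ]` as above is the same as an element `P(λ)` of
`U^{*c}[λ]`, by `⟨P(λ), u⟩_μ = G(u)`. -/
def toDualPoly [Module.Finite k[X] U] :
    ↥(dualFamily k U) →ₗ[k] PolynomialModule k (ConformalDual k U) where
  toFun G := PolynomialModule.ofCoeff k
    (Finsupp.ofSupportFinite (fun n => familyCoeff n G) (familyCoeff_finite G))
  map_add' G H := by
    ext1; ext1 n; exact map_add (familyCoeff n) G H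
  map_smul' c G := by
    ext1; ext1 n; exact map_smul (familyCoeff n) c G

theorem coeff_toDualPoly [Module.Finite k[X] U] (G : ↥(dualFamily k U)) (n : ℕ) :
    (toDualPoly G).coeff n = familyCoeff n G := rfl

theorem toDualPoly_var [Module.Finite k[X] U] {G H : ↥(dualFamily k U)}
    (h : ∀ u, H.1 u = X * G.1 u) : toDualPoly H = (X : k[X]) • toDualPoly G := by
  ext1; ext1 n
  rw [coeff_toDualPoly, ← monomial_one_one_eq_X, PolynomialModule.monomial_smul_apply,
    coeff_toDualPoly]
  refine dual_ext fun u => ?_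
  rw [pairing_familyCoeff, h]
  cases n with
  | zero => simp
  | succ n => simp [pairing_familyCoeff]

theorem coeff_polyDer {V : Type*} [AddCommGroup V] [Module k V] [Module k[X] V]
    [IsScalarTower k k[X] V] (p : PolynomialModule k V) (n : ℕ) :
    (polyDer k V p).coeff n = (X : k[X]) • p.coeff n := by
  simp [polyDer, PolynomialModule.map]

theorem toDualPoly_der [Module.Finite k[X] U] {G H : ↥(dualFamily k U)}
    (h : ∀ u, H.1 u = -(C X * G.1 u)) : toDualPoly H = polyDer k _ (toDualPoly G) := by
  ext1; ext1 n
  rw [coeff_toDualPoly, coeff_polyDer, coeff_toDualPoly]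
  refine dual_ext fun u => ?_
  rw [pairing_familyCoeff, h, pairing_X_smul_left, pairing_familyCoeff]
  simp

variable (k U)

/-- The substitution `p(λ) ↦ p(μ - λ)` from `k[λ]` to `k[μ][λ]`. -/
def substDiff : k[X] →ₐ[k] k[X][X] := aeval (C X - X)

/-- The substitution `p(λ) ↦ p(λ)` from `k[λ]` to `k[μ][λ]`. -/
def substOuter : k[X] →ₐ[k] k[X][X] := aeval X

/-- For `f ∈ U^{*c}` and `P(λ) = ∑ λⁿ uₙ ∈ U[λ]`, the polynomial
`⟨f, P(λ)⟩_{μ-λ} = ∑ λⁿ ⟨f, uₙ⟩_{μ-λ} ∈ k[μ][λ]`. -/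
def pairDiff : ConformalDual k U →ₗ[k] PolynomialModule k U →ₗ[k] k[X][X] :=
  LinearMap.mk₂ k (fun f P => P.coeff.sum fun n u => X ^ n * substDiff k (pairing k U f u))
    (fun f g P => by simp [mul_add, Finsupp.sum_add])
    (fun c f P => by simp [Finsupp.smul_sum])
    (fun f P R => by
      rw [PolynomialModule.coeff_add, Finsupp.sum_add_index'] <;> simp [mul_add])
    (fun c f P => by
      change Finsupp.sum (c • P.coeff) _ = _
      rw [Finsupp.sum_smul_index'] <;> simp [Finsupp.smul_sum])

variable {k U}

theorem pairDiff_single (f : ConformalDual k U) (n : ℕ) (u : U) :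
    pairDiff k U f (PolynomialModule.single k n u) = X ^ n * substDiff k (pairing k U f u) := by
  simp [pairDiff]

theorem pairDiff_var (f : ConformalDual k U) (P : PolynomialModule k U) :
    pairDiff k U f ((X : k[X]) • P) = X * pairDiff k U f P := by
  induction P using PolynomialModule.induction_linear with
  | zero => simp
  | add p q hp hq => rw [smul_add, map_add, map_add, hp, hq, mul_add]
  | single n v =>
    rw [← monomial_one_one_eq_X, PolynomialModule.monomial_smul_single, pairDiff_single,
      pairDiff_single, one_smul]
    ring

theorem pairDiff_polyDer (f : ConformalDual k U) (P : PolynomialModule k U) :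
    pairDiff k U f (polyDer k U P) = (C X - X) * pairDiff k U f P := by
  induction P using PolynomialModule.induction_linear with
  | zero => simp
  | add p q hp hq => rw [map_add, map_add, map_add, hp, hq, mul_add]
  | single n v =>
    rw [polyDer_single, pairDiff_single, pairDiff_single, pairing_X_smul_right, map_mul]
    simp only [substDiff, aeval_X]
    ring

theorem pairDiff_X_smul (f : ConformalDual k U) (P : PolynomialModule k U) :
    pairDiff k U ((X : k[X]) • f) P = -((C X - X) * pairDiff k U f P) := by
  induction P using PolynomialModule.induction_linear with
  | zero => simp
  | add p q hp hq => rw [map_add, map_add, hp, hq, mul_add, neg_add]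
  | single n v =>
    rw [pairDiff_single, pairDiff_single, pairing_X_smul_left, map_neg, map_mul]
    simp only [substDiff, aeval_X]
    ring

end DualPolynomials

section Actions

variable {k : Type*} [Field k]
variable {Q : Type*} [AddCommGroup Q] [Module k Q] [Module k[X] Q] [IsScalarTower k k[X] Q]
variable {M : Type*} [AddCommGroup M] [Module k M] [Module k[X] M] [IsScalarTower k k[X] M]
variable {N : Type*} [AddCommGroup N] [Module k N] [Module k[X] N] [IsScalarTower k k[X] N]

/-- The map `v ↦ -⟨f, l(a)_λ v⟩_{μ-λ}`. -/
def dualActionFamily (l : ConformalBilin k Q M M) (a : Q) (f : ConformalDual k M) :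
    ↥(dualFamily k M) :=
  ⟨-(pairDiff k M f ∘ₗ l.1 a), fun v => by
    simp only [LinearMap.neg_apply, LinearMap.comp_apply, l.2.2, map_add, pairDiff_var,
      pairDiff_polyDer]
    ring⟩

/-- The bilinear map underlying the action `l^*` of `Q` on `M^{*c}`. -/
def dualActionLin [Module.Finite k[X] M] (l : ConformalBilin k Q M M) :
    Q →ₗ[k] ConformalDual k M →ₗ[k] PolynomialModule k (ConformalDual k M) :=
  LinearMap.mk₂ k (fun a f => toDualPoly (dualActionFamily l a f))
    (fun a b f => by
      rw [← map_add]; congr 1; refine Subtype.ext (LinearMap.ext fun v => ?_)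
      simp [dualActionFamily]; abel)
    (fun c a f => by
      rw [← map_smul]; congr 1; refine Subtype.ext (LinearMap.ext fun v => ?_)
      simp [dualActionFamily])
    (fun a f g => by
      rw [← map_add]; congr 1; refine Subtype.ext (LinearMap.ext fun v => ?_)
      simp [dualActionFamily]; abel)
    (fun c a f => by
      rw [← map_smul]; congr 1; refine Subtype.ext (LinearMap.ext fun v => ?_)
      simp [dualActionFamily])

theorem toDualPoly_conformal [Module.Finite k[X] M] {G H : ↥(dualFamily k M)}
    (h : ∀ v, H.1 v = X * G.1 v - C X * G.1 v) :
    toDualPoly H = (X : k[X]) • toDualPoly G + polyDer k _ (toDualPoly G) := by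
  let G₁ : ↥(dualFamily k M) := ⟨LinearMap.mulLeft k X ∘ₗ G.1, fun v => by
    simp only [LinearMap.comp_apply, LinearMap.mulLeft_apply, G.2 v]; ring⟩
  let G₂ : ↥(dualFamily k M) := ⟨-(LinearMap.mulLeft k (C X) ∘ₗ G.1), fun v => by
    simp only [LinearMap.neg_apply, LinearMap.comp_apply, LinearMap.mulLeft_apply, G.2 v]
    ring⟩
  rw [← toDualPoly_var (G := G) (H := G₁) fun v => rfl,
    ← toDualPoly_der (G := G) (H := G₂) fun v => rfl, ← map_add]
  congr 1
  refine Subtype.ext (LinearMap.ext fun v => ?_)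
  rw [h, sub_eq_add_neg]; rfl

/-- The map `l^* : Q → Cend(M^{*c})` given by `⟨l^*(a)_λ f, v⟩_μ = -⟨f, l(a)_λ v⟩_{μ-λ}`. -/
def dualAction [Module.Finite k[X] M] (l : ConformalBilin k Q M M) :
    ConformalBilin k Q (ConformalDual k M) (ConformalDual k M) :=
  ⟨dualActionLin l, by
    refine ⟨fun a f => ?_, fun a f => ?_⟩
    · rw [← smul_neg, ← LinearMap.neg_apply, ← map_neg]
      refine toDualPoly_var fun v => ?_
      simp [dualActionFamily, l.2.1, pairDiff_var]
    · refine toDualPoly_conformal fun v => ?_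
      simp only [dualActionFamily, pairDiff_X_smul, LinearMap.neg_apply, LinearMap.comp_apply]
      ring⟩

theorem map_var (g : N →ₗ[k[X]] M) (p : PolynomialModule k N) :
    PolynomialModule.map k (g.restrictScalars k) ((X : k[X]) • p) =
      (X : k[X]) • PolynomialModule.map k (g.restrictScalars k) p := by
  rw [PolynomialModule.map_smul]; simp

theorem map_polyDer (g : N →ₗ[k[X]] M) (p : PolynomialModule k N) :
    PolynomialModule.map k (g.restrictScalars k) (polyDer k N p) =
      polyDer k M (PolynomialModule.map k (g.restrictScalars k) p) := by
  induction p using PolynomialModule.induction_linear with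
  | zero => simp
  | add p q hp hq => simp only [map_add, hp, hq]
  | single n v => simp [polyDer_single]

/-- Transport of `l : Q → Cend(N)` to `M` along an isomorphism `e : M ≃ N` of `k[∂]`-modules, that
is `(a, v) ↦ e⁻¹(l(a)_λ e(v))`. -/
def transport (e : M ≃ₗ[k[X]] N) (l : ConformalBilin k Q N N) : ConformalBilin k Q M M :=
  ⟨(l.1.compl₁₂ LinearMap.id (e.toLinearMap.restrictScalars k)).compr₂
    (PolynomialModule.map k (e.symm.toLinearMap.restrictScalars k)), by
    refine ⟨fun a v => ?_, fun a v => ?_⟩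
    · simp only [LinearMap.compr₂_apply, LinearMap.compl₁₂_apply, LinearMap.id_apply, l.2.1,
        map_neg, map_var]
    · simp only [LinearMap.compr₂_apply, LinearMap.compl₁₂_apply, LinearMap.id_apply,
        LinearMap.restrictScalars_apply, LinearEquiv.coe_coe, map_smul, l.2.2, map_add,
        map_var, map_polyDer]⟩

/-- `L(a)_λ b = [a_λ b]` is the bracket itself; this is `R(a)_λ b = [b_{-λ-∂} a]`. -/
def rightMul (br : ConformalBilin k Q Q Q) : ConformalBilin k Q Q Q :=
  ⟨br.1.flip.compr₂ (reflect k Q), by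
    refine ⟨fun a b => ?_, fun a b => ?_⟩
    · simp only [LinearMap.compr₂_apply, LinearMap.flip_apply, br.2.2, map_add, reflect_var,
        reflect_der]
      abel
    · simp only [LinearMap.compr₂_apply, LinearMap.flip_apply, br.2.1, map_neg, reflect_var]
      abel⟩

/-- `L^* : Q → Cend(Q^{*c})`. -/
def Lstar [Module.Finite k[X] Q] (br : ConformalBilin k Q Q Q) :
    ConformalBilin k Q (ConformalDual k Q) (ConformalDual k Q) := dualAction br

/-- `R^* : Q → Cend(Q^{*c})`. -/
def Rstar [Module.Finite k[X] Q] (br : ConformalBilin k Q Q Q) :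
    ConformalBilin k Q (ConformalDual k Q) (ConformalDual k Q) := dualAction (rightMul br)

variable [Module.Finite k[X] Q] [Module.Free k[X] Q]

/-- `𝓛^* : Q^{*c} → Cend(Q)`, for a bracket on `Q^{*c}`; here `Q` is identified with its double
conformal dual. -/
def calLstar (br' : ConformalBilin k (ConformalDual k Q) (ConformalDual k Q) (ConformalDual k Q)) :
    ConformalBilin k (ConformalDual k Q) Q Q := transport (doubleDualEquiv k Q) (Lstar br')

/-- `𝓡^* : Q^{*c} → Cend(Q)`, for a bracket on `Q^{*c}`. -/
def calRstar (br' : ConformalBilin k (ConformalDual k Q) (ConformalDual k Q) (ConformalDual k Q)) :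
    ConformalBilin k (ConformalDual k Q) Q Q := transport (doubleDualEquiv k Q) (Rstar br')

end Actions

section Leibniz

variable {k : Type*} [Field k]
variable {Q : Type*} [AddCommGroup Q] [Module k Q] [Module k[X] Q] [IsScalarTower k k[X] Q]
variable {M : Type*} [AddCommGroup M] [Module k M] [Module k[X] M] [IsScalarTower k k[X] M]

/-- A `λ`-bracket is that of a Leibniz conformal algebra if
`[a_λ [b_μ c]] = [[a_λ b]_{λ+μ} c] + [b_μ [a_λ c]]`.  Conformal sesquilinearity is part of
`ConformalBilin`. -/
def IsLeibniz (br : ConformalBilin k Q Q Q) : Prop :=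
  ∀ (l m : k) (a b c : Q),
    ev br l a (ev br m b c) = ev br (l + m) (ev br l a b) c + ev br m b (ev br l a c)

/-- `(M, l, r)` is a representation of `Q`. -/
structure IsRepresentation (br : ConformalBilin k Q Q Q) (l r : ConformalBilin k Q M M) :
    Prop where
  left_left : ∀ (s t : k) (a b : Q) (v : M),
    ev l s a (ev l t b v) = ev l (s + t) (ev br s a b) v + ev l t b (ev l s a v)
  left_right : ∀ (s t : k) (a b : Q) (v : M),
    ev l s a (evD r (-t) b v) = evD r (-s - t) b (ev l s a v) + evD r (-t) (ev br s a b) v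
  right_right : ∀ (s t : k) (a b : Q) (v : M),
    evD r (-s - t) b (evD r (-t) a v) = -evD r (-s - t) b (ev l s a v)

variable {Q₁ : Type*} [AddCommGroup Q₁] [Module k Q₁] [Module k[X] Q₁] [IsScalarTower k k[X] Q₁]
variable {Q₂ : Type*} [AddCommGroup Q₂] [Module k Q₂] [Module k[X] Q₂] [IsScalarTower k k[X] Q₂]

/-- `(Q₁, Q₂; (l, r), (φ, ψ))` is a matched pair of Leibniz conformal algebras; in the six
compatibility conditions, `s` and `t` are the values of `λ` and `μ`. -/
structure IsMatchedPair (br₁ : ConformalBilin k Q₁ Q₁ Q₁) (br₂ : ConformalBilin k Q₂ Q₂ Q₂)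
    (l r : ConformalBilin k Q₁ Q₂ Q₂) (φ ψ : ConformalBilin k Q₂ Q₁ Q₁) : Prop where
  leibniz₁ : IsLeibniz br₁
  leibniz₂ : IsLeibniz br₂
  rep₁ : IsRepresentation br₁ l r
  rep₂ : IsRepresentation br₂ φ ψ
  cond₁ : ∀ (s t : k) (a : Q₁) (x y : Q₂),
    ev br₂ s x (evD r (-t) a y) + evD r (-s) (ev φ t y a) x =
      evD r (-s - t) a (ev br₂ s x y) + ev br₂ t y (evD r (-s) a x) + evD r (-t) (ev φ s x a) y
  cond₂ : ∀ (s t : k) (a : Q₁) (x y : Q₂),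
    ev l s a (ev br₂ t x y) =
      ev br₂ (s + t) (ev l s a x) y + ev l (s + t) (evD ψ (-s) x a) y +
        ev br₂ t x (ev l s a y) + evD r (-t) (evD ψ (-s) y a) x
  cond₃ : ∀ (s t : k) (a : Q₁) (x y : Q₂),
    ev br₂ s x (ev l t a y) + evD r (-s) (evD ψ (-t) y a) x =
      ev l (s + t) (ev φ s x a) y + ev l t a (ev br₂ s x y) + ev br₂ (s + t) (evD r (-s) a x) y
  cond₄ : ∀ (s t : k) (a b : Q₁) (x : Q₂),
    ev br₁ s a (evD ψ (-t) x b) + evD ψ (-s) (ev l t b x) a =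
      evD ψ (-s - t) x (ev br₁ s a b) + ev br₁ t b (evD ψ (-s) x a) + evD ψ (-t) (ev l s a x) b
  cond₅ : ∀ (s t : k) (a b : Q₁) (x : Q₂),
    ev br₁ s a (ev φ t x b) + evD ψ (-s) (evD r (-t) b x) a =
      ev br₁ (s + t) (evD ψ (-s) x a) b + ev φ (s + t) (ev l s a x) b + ev φ t x (ev br₁ s a b)
  cond₆ : ∀ (s t : k) (a b : Q₁) (x : Q₂),
    ev br₁ (s + t) (ev φ s x a) b + ev φ (s + t) (evD r (-s) a x) b +
      ev br₁ (s + t) (evD ψ (-t) x a) b + ev φ (s + t) (ev l t a x) b = 0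

end Leibniz

section ManinTriple

variable (k : Type*) [Field k]
variable (E : Type*) [AddCommGroup E] [Module k E] [Module k[X] E] [IsScalarTower k k[X] E]

/-- Conformal bilinear forms on `E`: the `k`-bilinear maps `B_λ : E × E → k[λ]` with
`B_λ(∂u, v) = -λ B_λ(u, v)` and `B_λ(u, ∂v) = λ B_λ(u, v)`. -/
def conformalForm : Submodule k (E →ₗ[k] E →ₗ[k] k[X]) where
  carrier := {B | (∀ u v, B ((X : k[X]) • u) v = -(X * B u v)) ∧
    ∀ u v, B u ((X : k[X]) • v) = X * B u v}
  add_mem' := by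
    rintro f g ⟨hf, hf'⟩ ⟨hg, hg'⟩
    refine ⟨fun u v => ?_, fun u v => ?_⟩
    · simp only [LinearMap.add_apply, hf, hg, mul_add, neg_add]
    · simp only [LinearMap.add_apply, hf', hg', mul_add]
  zero_mem' := by constructor <;> simp
  smul_mem' := by
    rintro c f ⟨hf, hf'⟩
    refine ⟨fun u v => ?_, fun u v => ?_⟩
    · simp only [LinearMap.smul_apply, hf, smul_neg, mul_smul_comm]
    · simp only [LinearMap.smul_apply, hf', mul_smul_comm]

variable {k E}

/-- The map `E → E^{*c}`, `v ↦ B_λ(v, ·)`. -/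
def formToDual (B : ↥(conformalForm k E)) (v : E) : ConformalDual k E :=
  mkDual (B.1 v) (B.2.2 v)

/-- `(E, E₀, E₁)` is a conformal Manin triple of Leibniz conformal algebras, with bracket `br` and
form `B` on `E`. -/
structure IsConformalManinTriple (br : ConformalBilin k E E E) (B : ↥(conformalForm k E))
    (E₀ E₁ : Submodule k[X] E) : Prop where
  leibniz : IsLeibniz br
  finite : Module.Finite k[X] E
  finite₀ : Module.Finite k[X] E₀
  finite₁ : Module.Finite k[X] E₁
  nondegenerate : Function.Bijective (formToDual B)
  skew : ∀ u v, B.1 u v = -(B.1 v u).comp (-X)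
  invariant : ∀ (l m : k) (a b c : E),
    (B.1 a (ev br l b c)).eval m = (B.1 (ev br m a c + evD br (-m) c a) b).eval (-l)
  subalgebra₀ : ∀ a ∈ E₀, ∀ b ∈ E₀, ∀ n, (br.1 a b).coeff n ∈ E₀
  subalgebra₁ : ∀ a ∈ E₁, ∀ b ∈ E₁, ∀ n, (br.1 a b).coeff n ∈ E₁
  isCompl : IsCompl E₀ E₁
  isotropic₀ : ∀ a ∈ E₀, ∀ b ∈ E₀, B.1 a b = 0
  isotropic₁ : ∀ a ∈ E₁, ∀ b ∈ E₁, B.1 a b = 0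

variable (k)
variable (Q : Type*) [AddCommGroup Q] [Module k Q] [Module k[X] Q] [IsScalarTower k k[X] Q]

/-- The form `B_λ(a + f, b + g) = ⟨f, b⟩_λ - ⟨g, a⟩_{-λ}` on `Q ⊕ Q^{*c}`. -/
def standardForm : ↥(conformalForm k (Q × ConformalDual k Q)) :=
  ⟨LinearMap.mk₂ k (fun u v => pairing k Q u.2 v.1 - (pairing k Q v.2 u.1).comp (-X))
    (fun u u' v => by simp; ring)
    (fun c u v => by simp [smul_sub])
    (fun u v v' => by simp; ring)
    (fun c u v => by simp [smul_sub]), by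
    refine ⟨fun u v => ?_, fun u v => ?_⟩
    · simp [pairing_X_smul_left, pairing_X_smul_right]; ring
    · simp [pairing_X_smul_left, pairing_X_smul_right]; ring⟩

variable {k Q}

/-- `br` is a `λ`-bracket on `Q ⊕ Q^{*c}` restricting to the given `λ`-brackets on the two
summands. -/
def ExtendsBrackets
    (br : ConformalBilin k (Q × ConformalDual k Q) (Q × ConformalDual k Q) (Q × ConformalDual k Q))
    (br₀ : ConformalBilin k Q Q Q)
    (br₁ : ConformalBilin k (ConformalDual k Q) (ConformalDual k Q) (ConformalDual k Q)) : Prop :=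
  (∀ a b, br.1 (a, 0) (b, 0) = PolynomialModule.map k (LinearMap.inl k Q (ConformalDual k Q))
    (br₀.1 a b)) ∧
  ∀ f g, br.1 (0, f) (0, g) = PolynomialModule.map k (LinearMap.inr k Q (ConformalDual k Q))
    (br₁.1 f g)

end ManinTriple

section Bialgebra

variable (k : Type*) [Field k]
variable (Q : Type*) [AddCommGroup Q] [Module k Q] [Module k[X] Q] [IsScalarTower k k[X] Q]

/-- `∂ ⊗ id` on `Q ⊗ Q`. -/
def derLeft : Module.End k (Q ⊗[k] Q) := (der k Q).rTensor Q

/-- `∂ ⊗ id + id ⊗ ∂` on `Q ⊗ Q`. -/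
def derTensor : Module.End k (Q ⊗[k] Q) := (der k Q).rTensor Q + (der k Q).lTensor Q

variable {k Q}

/-- `Δ : Q → Q ⊗ Q` is a homomorphism of `k[∂]`-modules, `∂` acting on `Q ⊗ Q` by
`∂ ⊗ id + id ⊗ ∂`. -/
def IsCobracket (Δ : Q →ₗ[k] Q ⊗[k] Q) : Prop :=
  ∀ a, Δ ((X : k[X]) • a) = derTensor k Q (Δ a)

/-- `(Q, Δ)` is a Leibniz conformal coalgebra:
`(id ⊗ Δ)Δ(a) = (Δ ⊗ id)Δ(a) + τ₁₂ (id ⊗ Δ)Δ(a)`. -/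
structure IsLeibnizCoalgebra (Δ : Q →ₗ[k] Q ⊗[k] Q) : Prop where
  cobracket : IsCobracket Δ
  coleibniz : ∀ a, Δ.lTensor Q (Δ a) =
    TensorProduct.assoc k Q Q Q (Δ.rTensor Q (Δ a)) +
      TensorProduct.leftComm k Q Q Q (Δ.lTensor Q (Δ a))

/-- For `F_λ : Q → Q[λ]` with `F_λ(u) = ∑ λⁿ Fₙ(u)` and an operator `T` on `Q ⊗ Q`, the operator
`F_T ⊗ id : u ⊗ v ↦ ∑ Tⁿ (Fₙ(u) ⊗ v)`. -/
def actLeft (F : Q →ₗ[k] PolynomialModule k Q) (T : Module.End k (Q ⊗[k] Q)) :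
    Module.End k (Q ⊗[k] Q) :=
  TensorProduct.lift <| ((Finsupp.lsum k fun n => (TensorProduct.mk k Q Q).compr₂ (T ^ n)) ∘ₗ
    (PolynomialModule.coeffLinearEquiv k k).toLinearMap) ∘ₗ F

/-- For `F_λ : Q → Q[λ]` with `F_λ(v) = ∑ λⁿ Fₙ(v)` and an operator `T` on `Q ⊗ Q`, the operator
`id ⊗ F_T : u ⊗ v ↦ ∑ Tⁿ (u ⊗ Fₙ(v))`. -/
def actRight (F : Q →ₗ[k] PolynomialModule k Q) (T : Module.End k (Q ⊗[k] Q)) :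
    Module.End k (Q ⊗[k] Q) :=
  TensorProduct.lift <| LinearMap.flip <|
    ((Finsupp.lsum k fun n => ((TensorProduct.mk k Q Q).compr₂ (T ^ n)).flip) ∘ₗ
      (PolynomialModule.coeffLinearEquiv k k).toLinearMap) ∘ₗ F

/-- `(Q, [·_λ ·], Δ)` is a Leibniz conformal bialgebra; `s` is the value of `λ`. -/
structure IsLeibnizBialgebra (br : ConformalBilin k Q Q Q) (Δ : Q →ₗ[k] Q ⊗[k] Q) : Prop where
  leibniz : IsLeibniz br
  coalgebra : IsLeibnizCoalgebra Δ
  compat₁ : ∀ (s : k) (a b : Q),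
    actLeft ((rightMul br).1 a) (s • 1 - derLeft k Q) (Δ b) =
      TensorProduct.comm k Q Q (actLeft ((rightMul br).1 b) (-s • 1 - derLeft k Q) (Δ a))
  compat₂ : ∀ (s : k) (a b : Q),
    Δ (ev br s a b) =
      (actRight ((rightMul br).1 b) (-s • 1 - derTensor k Q) -
        actLeft (br.1 b) (-s • 1 - derTensor k Q) -
        actLeft ((rightMul br).1 b) (-s • 1 - derTensor k Q))
        (TensorProduct.comm k Q Q (Δ a) + Δ a) +
      (actRight (br.1 a) (s • 1) + actLeft (br.1 a) (s • 1)) (Δ b)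

/-- For `f, g ∈ U^{*c}`, the map `a ⊗ b ↦ ⟨f, a⟩_λ ⟨g, b⟩_{μ-λ}` from `Q ⊗ Q` to `k[μ][λ]`. -/
def pairTensor : ConformalDual k Q →ₗ[k] ConformalDual k Q →ₗ[k] Q ⊗[k] Q →ₗ[k] k[X][X] :=
  LinearMap.mk₂ k (fun f g => TensorProduct.lift <|
      (LinearMap.mul k k[X][X]).compl₁₂ ((substOuter k).toLinearMap ∘ₗ pairing k Q f)
        ((substDiff k).toLinearMap ∘ₗ pairing k Q g))
    (fun f f' g => by ext; simp)
    (fun c f g => by ext; simp)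
    (fun f g g' => by ext; simp [mul_add])
    (fun c f g => by ext; simp)

theorem pairTensor_tmul (f g : ConformalDual k Q) (a b : Q) :
    pairTensor f g (a ⊗ₜ b) =
      substOuter k (pairing k Q f a) * substDiff k (pairing k Q g b) := by
  simp [pairTensor]

theorem pairTensor_derTensor (f g : ConformalDual k Q) (z : Q ⊗[k] Q) :
    pairTensor f g (derTensor k Q z) = C X * pairTensor f g z := by
  induction z using TensorProduct.induction_on with
  | zero => simp
  | add x y hx hy => rw [map_add, map_add, map_add, hx, hy, mul_add]
  | tmul a b =>
    simp only [derTensor, LinearMap.add_apply, LinearMap.rTensor_tmul, LinearMap.lTensor_tmul,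
      der_apply, map_add, pairTensor_tmul, pairing_X_smul_right, map_mul]
    simp only [substOuter, substDiff, aeval_X]
    ring

theorem pairTensor_left (f g : ConformalDual k Q) (z : Q ⊗[k] Q) :
    pairTensor ((X : k[X]) • f) g z = -(X * pairTensor f g z) := by
  induction z using TensorProduct.induction_on with
  | zero => simp
  | add x y hx hy => rw [map_add, map_add, hx, hy, mul_add, neg_add]
  | tmul a b =>
    simp only [pairTensor_tmul, pairing_X_smul_left, map_mul, map_neg]
    simp only [substOuter, substDiff, aeval_X]
    ring

theorem pairTensor_right (f g : ConformalDual k Q) (z : Q ⊗[k] Q) :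
    pairTensor f ((X : k[X]) • g) z = X * pairTensor f g z - C X * pairTensor f g z := by
  induction z using TensorProduct.induction_on with
  | zero => simp
  | add x y hx hy => rw [map_add, map_add, hx, hy]; ring
  | tmul a b =>
    simp only [pairTensor_tmul, pairing_X_smul_left, map_mul, map_neg]
    simp only [substOuter, substDiff, aeval_X]
    ring

/-- The map `a ↦ ⟨f ⊗ g, Δ(a)⟩_{λ, μ-λ}`. -/
def cobracketFamily (Δ : Q →ₗ[k] Q ⊗[k] Q) (hΔ : IsCobracket Δ) (f g : ConformalDual k Q) :
    ↥(dualFamily k Q) :=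
  ⟨pairTensor f g ∘ₗ Δ, fun a => by
    simp only [LinearMap.comp_apply, hΔ a, pairTensor_derTensor]⟩

/-- The bilinear map underlying the `λ`-bracket on `Q^{*c}` obtained from `Δ`. -/
def dualBracketLin [Module.Finite k[X] Q] (Δ : Q →ₗ[k] Q ⊗[k] Q) (hΔ : IsCobracket Δ) :
    ConformalDual k Q →ₗ[k] ConformalDual k Q →ₗ[k] PolynomialModule k (ConformalDual k Q) :=
  LinearMap.mk₂ k (fun f g => toDualPoly (cobracketFamily Δ hΔ f g))
    (fun f f' g => by
      rw [← map_add]; congr 1; refine Subtype.ext (LinearMap.ext fun v => ?_)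
      simp [cobracketFamily])
    (fun c f g => by
      rw [← map_smul]; congr 1; refine Subtype.ext (LinearMap.ext fun v => ?_)
      simp [cobracketFamily])
    (fun f g g' => by
      rw [← map_add]; congr 1; refine Subtype.ext (LinearMap.ext fun v => ?_)
      simp [cobracketFamily])
    (fun c f g => by
      rw [← map_smul]; congr 1; refine Subtype.ext (LinearMap.ext fun v => ?_)
      simp [cobracketFamily])

/-- The `λ`-bracket on `Q^{*c}` obtained from `Δ` by
`⟨[f_λ g], a⟩_μ = ⟨f ⊗ g, Δ(a)⟩_{λ, μ-λ}`. -/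
def dualBracket [Module.Finite k[X] Q] (Δ : Q →ₗ[k] Q ⊗[k] Q) (hΔ : IsCobracket Δ) :
    ConformalBilin k (ConformalDual k Q) (ConformalDual k Q) (ConformalDual k Q) :=
  ⟨dualBracketLin Δ hΔ, by
    refine ⟨fun f g => ?_, fun f g => ?_⟩
    · rw [← smul_neg, ← LinearMap.neg_apply, ← map_neg]
      refine toDualPoly_var fun v => ?_
      simp only [cobracketFamily, LinearMap.comp_apply, pairTensor_left]
      rw [← neg_one_smul k f, map_smul, LinearMap.smul_apply, LinearMap.smul_apply, neg_one_smul]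
      ring
    · exact toDualPoly_conformal fun v => pairTensor_right f g (Δ v)⟩

end Bialgebra

end LeibnizConformal

end

/-! Conformal identities become ordinary multilinear ones after evaluation at scalars. Attach to
each element of E the scalar by which -∂ is to act on it. Brackets then add scalars, a pairing makes
sense when the scalars sum to zero, and every substitution of -λ-∂ turns into an ordinary value
(`map_substEnd`, `map_evD`). Nothing is lost: k is infinite, being of characteristic zero, and Q is
free, so values of the pairing separate the points of Q, of its dual and of the tensor powers
involved.

All three conditions are compared with one statement: the bracket `doubleBracket` on the sum of Q
and its dual is Leibniz. For (a) this is the general fact that matched pairs are Leibniz brackets on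
a direct sum (`isMatchedPair_iff`). For (b), the standard form is invariant for `doubleBracket`
(`doubleBracket_isInvariantForm`), and no other extension of the two brackets has this property
(`ExtendsBrackets.ev_eq`). The reason for uniqueness is that among three elements taken from two
summands, two lie in the same one, and invariance can bring these two into the inner bracket.

For (c), let T(x,y,z) = B(x,[y,z]). Invariance says that T is symmetric in its outer arguments and
that its sum over the three choices of middle argument vanishes. Let J(d;a,b,c) be the Leibniz
defect of a, b, c paired with d. Together with skew-symmetry of B, these symmetries of T give linear
relations between the values of J on permuted arguments (`jac_swap_ends`, `jac_third`, `jac_second`,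
`jac_ends`). With L for Q and R for its dual, they reduce the sixteen patterns of four arguments to
six (`jac_eq_zero_of_onLeft_onRight`). Patterns LLLL and RRRR vanish by isotropy, RLLL and LRRR are
the Leibniz identities of Q and of its dual, and only LLRR and LRLR are left. Pattern LLRR is the
second bialgebra condition (`compat₂_iff`); the sum of LLRR and LRLR is the first (`compat₁_iff`).
The coalgebra axiom is the transpose of the Leibniz identity on the dual. -/

noncomputable section

namespace LeibnizConformal

/-! ### Substituting operators for the spectral variable -/

section Substitution

variable {k : Type*} [Field k]
variable {V : Type*} [AddCommGroup V] [Module k V] [Module k[X] V] [IsScalarTower k k[X] V]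
variable {N : Type*} [AddCommGroup N] [Module k N]

theorem substEnd_single (t : Module.End k V) (n : ℕ) (v : V) :
    substEnd t (PolynomialModule.single k n v) = (t ^ n) v := by
  simp [substEnd]

theorem eval_polyDer (c : k) (p : PolynomialModule k V) :
    PolynomialModule.eval c (polyDer k V p) = (X : k[X]) • PolynomialModule.eval c p :=
  PolynomialModule.eval_map' (der k V) p c

/-- This is what removes all substitutions of -λ-∂: a functional that turns the operator into a
scalar turns the substitution into an evaluation. -/
theorem map_substEnd (φ : V →ₗ[k] N) (t : Module.End k V) (c : k)
    (h : ∀ v, φ (t v) = c • φ v) (p : PolynomialModule k V) :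
    φ (substEnd t p) = φ (PolynomialModule.eval c p) := by
  induction p using PolynomialModule.induction_linear with
  | zero => simp
  | add p q hp hq => simp only [map_add, hp, hq]
  | single n v =>
    rw [substEnd_single, PolynomialModule.eval_single, map_smul]
    induction n with
    | zero => simp
    | succ n ih => rw [pow_succ', Module.End.mul_apply, h, ih, pow_succ', mul_smul]

theorem eval_reflect (c : k) (p : PolynomialModule k V) :
    PolynomialModule.eval c (reflect k V p) = substEnd ((-c) • 1 - der k V) p := by
  induction p using PolynomialModule.induction_linear with
  | zero => simp
  | add p q hp hq => simp only [map_add, hp, hq]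
  | single n v =>
    rw [reflect_single, substEnd_single]
    induction n with
    | zero => simp
    | succ n ih =>
      rw [pow_succ', Module.End.mul_apply, pow_succ', Module.End.mul_apply, ← ih]
      simp [eval_polyDer]

end Substitution

/-! ### Values of conformal bilinear maps at scalars -/

section Evaluation

variable {k : Type*} [Field k]
variable {U : Type*} [AddCommGroup U] [Module k U] [Module k[X] U] [IsScalarTower k k[X] U]
variable {V : Type*} [AddCommGroup V] [Module k V] [Module k[X] V] [IsScalarTower k k[X] V]
variable {W : Type*} [AddCommGroup W] [Module k W] [Module k[X] W] [IsScalarTower k k[X] W]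
variable {N : Type*} [AddCommGroup N] [Module k N]

section Linear

variable (f g : ConformalBilin k U V W) (c : k)

@[simp] theorem ev_add_left (u u' : U) (v : V) : ev f c (u + u') v = ev f c u v + ev f c u' v := by
  simp [ev]

@[simp] theorem ev_add_right (u : U) (v v' : V) :
    ev f c u (v + v') = ev f c u v + ev f c u v' := by
  simp [ev]

@[simp] theorem ev_zero_left (v : V) : ev f c 0 v = 0 := by simp [ev]

@[simp] theorem ev_zero_right (u : U) : ev f c u 0 = 0 := by simp [ev]

@[simp] theorem ev_neg_left (u : U) (v : V) : ev f c (-u) v = -ev f c u v := by simp [ev]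

@[simp] theorem ev_sub_left (u u' : U) (v : V) : ev f c (u - u') v = ev f c u v - ev f c u' v := by
  simp [ev]

theorem ev_X_smul_left (u : U) (v : V) : ev f c ((X : k[X]) • u) v = -(c • ev f c u v) := by
  simp [ev, f.2.1]

@[simp] theorem evD_add_left (u u' : U) (v : V) :
    evD f c (u + u') v = evD f c u v + evD f c u' v := by
  simp [evD]

@[simp] theorem evD_add_right (u : U) (v v' : V) :
    evD f c u (v + v') = evD f c u v + evD f c u v' := by
  simp [evD]

@[simp] theorem evD_zero_left (v : V) : evD f c 0 v = 0 := by simp [evD]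

@[simp] theorem evD_zero_right (u : U) : evD f c u 0 = 0 := by simp [evD]

theorem ev_add (u : U) (v : V) : ev (f + g) c u v = ev f c u v + ev g c u v := by simp [ev]

theorem ev_neg (u : U) (v : V) : ev (-f) c u v = -ev f c u v := by simp [ev]

theorem ev_sub (u : U) (v : V) : ev (f - g) c u v = ev f c u v - ev g c u v := by simp [ev]

/-- The bilinear map `f_c : U × V → W`, for a scalar `c`. -/
def evLin : U →ₗ[k] V →ₗ[k] W := f.1.compr₂ (PolynomialModule.eval c)

theorem evLin_apply (u : U) (v : V) : evLin f c u v = ev f c u v := rfl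

/-- If `∂` acts through the scalar `p` after applying `φ`, then `φ (f_{c-∂}(u, v))` is
`φ (f_{c-p}(u, v))`. -/
theorem map_evD (φ : W →ₗ[k] N) (p : k) (h : ∀ w, φ ((X : k[X]) • w) = p • φ w) (u : U) (v : V) :
    φ (evD f c u v) = φ (ev f (c - p) u v) := by
  refine map_substEnd φ _ _ (fun w => ?_) _
  simp [h, sub_smul]

end Linear

/-- The conformal bilinear map `(v, u) ↦ f_{-λ-∂}(u, v)`. -/
def flipBilin (f : ConformalBilin k U V W) : ConformalBilin k V U W :=
  ⟨f.1.flip.compr₂ (reflect k W), by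
    refine ⟨fun a b => ?_, fun a b => ?_⟩
    · simp only [LinearMap.compr₂_apply, LinearMap.flip_apply, f.2.2, map_add, reflect_var,
        reflect_der]
      abel
    · simp only [LinearMap.compr₂_apply, LinearMap.flip_apply, f.2.1, map_neg, reflect_var]
      abel⟩

theorem ev_flipBilin (f : ConformalBilin k U V W) (c : k) (v : V) (u : U) :
    ev (flipBilin f) c v u = evD f (-c) u v := eval_reflect c (f.1 u v)

theorem ev_rightMul (br : ConformalBilin k V V V) (c : k) (v u : V) :
    ev (rightMul br) c v u = evD br (-c) u v := eval_reflect c (br.1 u v)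

variable {U' : Type*} [AddCommGroup U'] [Module k U'] [Module k[X] U'] [IsScalarTower k k[X] U']
variable {V' : Type*} [AddCommGroup V'] [Module k V'] [Module k[X] V'] [IsScalarTower k k[X] V']
variable {W' : Type*} [AddCommGroup W'] [Module k W'] [Module k[X] W'] [IsScalarTower k k[X] W']

/-- The composite of a conformal bilinear map with homomorphisms of `k[∂]`-modules. -/
def compBilin (p : U' →ₗ[k[X]] U) (q : V' →ₗ[k[X]] V) (i : W →ₗ[k[X]] W')
    (f : ConformalBilin k U V W) : ConformalBilin k U' V' W' :=
  ⟨(f.1.compl₁₂ (p.restrictScalars k) (q.restrictScalars k)).compr₂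
    (PolynomialModule.map k (i.restrictScalars k)), by
    refine ⟨fun a v => ?_, fun a v => ?_⟩
    · simp only [LinearMap.compr₂_apply, LinearMap.compl₁₂_apply, LinearMap.restrictScalars_apply,
        map_smul, f.2.1, map_neg, map_var]
    · simp only [LinearMap.compr₂_apply, LinearMap.compl₁₂_apply,
        LinearMap.restrictScalars_apply, map_smul, f.2.2, map_add, map_var, map_polyDer]⟩

theorem compBilin_apply (p : U' →ₗ[k[X]] U) (q : V' →ₗ[k[X]] V) (i : W →ₗ[k[X]] W')
    (f : ConformalBilin k U V W) (u : U') (v : V') :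
    (compBilin p q i f).1 u v = PolynomialModule.map k (i.restrictScalars k) (f.1 (p u) (q v)) :=
  rfl

theorem ev_compBilin (p : U' →ₗ[k[X]] U) (q : V' →ₗ[k[X]] V) (i : W →ₗ[k[X]] W')
    (f : ConformalBilin k U V W) (c : k) (u : U') (v : V') :
    ev (compBilin p q i f) c u v = i (ev f c (p u) (q v)) := by
  rw [ev, ev, compBilin_apply]
  exact PolynomialModule.eval_map k (i.restrictScalars k) (f.1 (p u) (q v)) c

end Evaluation

/-! ### Values of the pairing with the conformal dual -/

section Pairing

variable {k : Type*} [Field k]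
variable {U : Type*} [AddCommGroup U] [Module k U] [Module k[X] U] [IsScalarTower k k[X] U]
variable {Q : Type*} [AddCommGroup Q] [Module k Q] [Module k[X] Q] [IsScalarTower k k[X] Q]

/-- The value of the pairing `⟨f, u⟩_s ∈ k` at a scalar `s`. -/
def pairEv (s : k) : ConformalDual k U →ₗ[k] U →ₗ[k] k :=
  (pairing k U).compr₂ (leval s)

theorem pairEv_apply (s : k) (f : ConformalDual k U) (u : U) :
    pairEv s f u = (pairing k U f u).eval s := rfl

theorem pairEv_X_smul_right (s : k) (f : ConformalDual k U) (u : U) :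
    pairEv s f ((X : k[X]) • u) = s * pairEv s f u := by
  simp [pairEv_apply, pairing_X_smul_right]

theorem pairEv_X_smul_left (s : k) (f : ConformalDual k U) (u : U) :
    pairEv s ((X : k[X]) • f) u = -(s * pairEv s f u) := by
  simp [pairEv_apply, pairing_X_smul_left]

theorem pairEv_evD_right {A B : Type*} [AddCommGroup A] [Module k A] [Module k[X] A]
    [IsScalarTower k k[X] A] [AddCommGroup B] [Module k B] [Module k[X] B] [IsScalarTower k k[X] B]
    (g : ConformalBilin k A B U) (s c : k) (f : ConformalDual k U) (a : A) (b : B) :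
    pairEv s f (evD g c a b) = pairEv s f (ev g (c - s) a b) :=
  map_evD g c (pairEv s f) s (pairEv_X_smul_right s f) a b

/-- On the dual, ∂ acts under the pairing by -s rather than s, hence c + s here against c - s in
`pairEv_evD_right`. -/
theorem pairEv_evD_left {A B : Type*} [AddCommGroup A] [Module k A] [Module k[X] A]
    [IsScalarTower k k[X] A] [AddCommGroup B] [Module k B] [Module k[X] B] [IsScalarTower k k[X] B]
    (g : ConformalBilin k A B (ConformalDual k U)) (s c : k) (u : U) (a : A) (b : B) :
    pairEv s (evD g c a b) u = pairEv s (ev g (c + s) a b) u := by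
  have := map_evD g c ((pairEv s).flip u) (-s) (fun f => by simp [pairEv_X_smul_left]) a b
  simpa using this

theorem pairEv_doubleDual (s : k) (a : U) (f : ConformalDual k U) :
    pairEv s (doubleDual k U a) f = pairEv (-s) f a := by
  simp [pairEv_apply, pairing_doubleDual]

theorem pairEv_ext [Infinite k] {f g : ConformalDual k U}
    (h : ∀ s u, pairEv s f u = pairEv s g u) : f = g :=
  dual_ext fun u => Polynomial.funext fun s => h s u

/-- The coordinate functions of a basis are elements of the dual, and a polynomial over an infinite
field is determined by its values. -/
theorem eq_zero_of_pairEv [Infinite k] [Module.Free k[X] U] (u : U)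
    (h : ∀ s f, pairEv s f u = (0 : k)) : u = 0 := by
  let b := Module.Free.chooseBasis k[X] U
  refine b.ext_elem fun i => ?_
  have : pairing k U (ofLinear (b.coord i)) u = 0 :=
    Polynomial.funext fun s => by simpa [pairEv_apply] using h s (ofLinear (b.coord i))
  simpa [pairing_ofLinear] using this

theorem pairing_eval_toDualPoly [Module.Finite k[X] U] (G : ↥(dualFamily k U)) (s : k) (u : U) :
    pairing k U (PolynomialModule.eval s (toDualPoly G)) u = (G.1 u).eval (C s) := by
  have h : PolynomialModule.eval s (toDualPoly G) =
      (toDualPoly G).coeff.sum fun n f => s ^ n • f := rfl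
  rw [h, Finsupp.sum, map_sum, LinearMap.sum_apply, eval_eq_sum, Polynomial.sum]
  -- The support of the polynomial at u lies in the support of the whole family; the additional
  -- coefficients pair to zero with u.
  refine ((Finset.sum_subset (fun n hn => ?_) fun n _ hn => ?_).trans
    (Finset.sum_congr rfl fun n _ => ?_)).symm
  · rw [Finsupp.mem_support_iff, coeff_toDualPoly]
    intro h0
    rw [mem_support_iff, ← pairing_familyCoeff, h0] at hn
    simp at hn
  · rw [notMem_support_iff.mp hn, zero_mul]
  · rw [coeff_toDualPoly, map_smul, LinearMap.smul_apply, pairing_familyCoeff, ← C_pow,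
      mul_comm, ← smul_eq_C_mul]

theorem pairEv_eval_toDualPoly [Module.Finite k[X] U] (G : ↥(dualFamily k U)) (s t : k) (u : U) :
    pairEv t (PolynomialModule.eval s (toDualPoly G)) u = ((G.1 u).eval (C s)).eval t := by
  rw [pairEv_apply, pairing_eval_toDualPoly]

theorem eval_eval_substDiff (p : k[X]) (s t : k) :
    ((substDiff k p).eval (C s)).eval t = p.eval (t - s) := by
  induction p using Polynomial.induction_on' with
  | add p q hp hq => simp only [map_add, eval_add, hp, hq]
  | monomial n c =>
    rw [← C_mul_X_pow_eq_monomial, ← smul_eq_C_mul, map_smul]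
    simp [substDiff]

theorem eval_eval_substOuter (p : k[X]) (s t : k) :
    ((substOuter k p).eval (C s)).eval t = p.eval s := by
  induction p using Polynomial.induction_on' with
  | add p q hp hq => simp only [map_add, eval_add, hp, hq]
  | monomial n c =>
    rw [← C_mul_X_pow_eq_monomial, ← smul_eq_C_mul, map_smul]
    simp [substOuter]

theorem eval_eval_pairDiff (f : ConformalDual k U) (P : PolynomialModule k U) (s t : k) :
    ((pairDiff k U f P).eval (C s)).eval t = pairEv (t - s) f (PolynomialModule.eval s P) := by
  induction P using PolynomialModule.induction_linear with
  | zero => simp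
  | add p q hp hq => simp only [map_add, eval_add, hp, hq]
  | single n u =>
    rw [pairDiff_single, eval_mul, eval_mul, eval_eval_substDiff, PolynomialModule.eval_single,
      map_smul, pairEv_apply]
    simp

theorem pairEv_dualAction [Module.Finite k[X] U] (l : ConformalBilin k Q U U) (s t : k) (a : Q)
    (f : ConformalDual k U) (u : U) :
    pairEv t (ev (dualAction l) s a f) u = -pairEv (t - s) f (ev l s a u) := by
  have h : ev (dualAction l) s a f =
      PolynomialModule.eval s (toDualPoly (dualActionFamily l a f)) := rfl
  rw [h, pairEv_eval_toDualPoly, ev, ← eval_eval_pairDiff]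
  simp [dualActionFamily]

/-- The value of the pairing `⟨f ⊗ g, z⟩_{s,t} ∈ k` at scalars `s`, `t`. -/
def pairEv₂ (s t : k) (f g : ConformalDual k Q) : Q ⊗[k] Q →ₗ[k] k :=
  TensorProduct.lift ((LinearMap.mul k k).compl₁₂ (pairEv s f) (pairEv t g))

@[simp] theorem pairEv₂_tmul (s t : k) (f g : ConformalDual k Q) (u v : Q) :
    pairEv₂ s t f g (u ⊗ₜ v) = pairEv s f u * pairEv t g v := by
  simp [pairEv₂]

theorem pairEv_dualBracket [Module.Finite k[X] Q] (Δ : Q →ₗ[k] Q ⊗[k] Q) (hΔ : IsCobracket Δ)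
    (s t : k) (f g : ConformalDual k Q) (a : Q) :
    pairEv t (ev (dualBracket Δ hΔ) s f g) a = pairEv₂ s (t - s) f g (Δ a) := by
  have h : ev (dualBracket Δ hΔ) s f g =
      PolynomialModule.eval s (toDualPoly (cobracketFamily Δ hΔ f g)) := rfl
  rw [h, pairEv_eval_toDualPoly]
  change ((pairTensor f g (Δ a)).eval (C s)).eval t = _
  induction Δ a using TensorProduct.induction_on with
  | zero => simp
  | add x y hx hy => simp only [map_add, eval_add, hx, hy]
  | tmul u v =>
    rw [pairTensor_tmul, eval_mul, eval_mul, eval_eval_substDiff, eval_eval_substOuter,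
      pairEv₂_tmul, pairEv_apply, pairEv_apply]

theorem ev_transport {N : Type*} [AddCommGroup N] [Module k N] [Module k[X] N]
    [IsScalarTower k k[X] N] {M : Type*} [AddCommGroup M] [Module k M] [Module k[X] M]
    [IsScalarTower k k[X] M] (e : M ≃ₗ[k[X]] N) (l : ConformalBilin k Q N N) (s : k) (a : Q)
    (m : M) : ev (transport e l) s a m = e.symm (ev l s a (e m)) :=
  ev_compBilin LinearMap.id e.toLinearMap e.symm.toLinearMap l s a m

variable [Module.Finite k[X] Q] [Module.Free k[X] Q]

/-- The identification with the double dual changes the sign of the parameter. It is used once in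
each direction, so the shift t - s of a dual action becomes t + s. -/
theorem pairEv_transport_dualAction
    (l : ConformalBilin k (ConformalDual k Q) (ConformalDual k Q) (ConformalDual k Q))
    (s t : k) (f g : ConformalDual k Q) (a : Q) :
    pairEv t g (ev (transport (doubleDualEquiv k Q) (dualAction l)) s f a) =
      -pairEv (t + s) (ev l s f g) a := by
  have h (x : Q) : pairEv t g x = pairEv (-t) (doubleDualEquiv k Q x) g := by
    rw [← neg_neg t, neg_neg (-t)]
    exact (pairEv_doubleDual (-t) x g).symm
  rw [h, ev_transport, LinearEquiv.apply_symm_apply, pairEv_dualAction]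
  have h' := pairEv_doubleDual (-t - s) a (ev l s f g)
  rw [show -(-t - s) = t + s by ring] at h'
  rw [← h']; rfl

end Pairing

/-! ### Matched pairs as Leibniz brackets on a direct sum -/

section MatchedPairs

variable {k : Type*} [Field k]
variable {Q₁ : Type*} [AddCommGroup Q₁] [Module k Q₁] [Module k[X] Q₁] [IsScalarTower k k[X] Q₁]
variable {Q₂ : Type*} [AddCommGroup Q₂] [Module k Q₂] [Module k[X] Q₂] [IsScalarTower k k[X] Q₂]

/-- The `λ`-bracket
`[(a + x)_λ (b + y)] = [a_λ b] + φ(x)_λ b + ψ(y)_{-λ-∂} a + [x_λ y] + l(a)_λ y + r(b)_{-λ-∂} x`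
on `Q₁ ⊕ Q₂`. -/
def bowtie (br₁ : ConformalBilin k Q₁ Q₁ Q₁) (br₂ : ConformalBilin k Q₂ Q₂ Q₂)
    (l r : ConformalBilin k Q₁ Q₂ Q₂) (φ ψ : ConformalBilin k Q₂ Q₁ Q₁) :
    ConformalBilin k (Q₁ × Q₂) (Q₁ × Q₂) (Q₁ × Q₂) :=
  compBilin (LinearMap.fst _ _ _) (LinearMap.fst _ _ _) (LinearMap.inl _ _ _) br₁ +
  compBilin (LinearMap.snd _ _ _) (LinearMap.fst _ _ _) (LinearMap.inl _ _ _) φ +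
  compBilin (LinearMap.fst _ _ _) (LinearMap.snd _ _ _) (LinearMap.inl _ _ _) (flipBilin ψ) +
  compBilin (LinearMap.snd _ _ _) (LinearMap.snd _ _ _) (LinearMap.inr _ _ _) br₂ +
  compBilin (LinearMap.fst _ _ _) (LinearMap.snd _ _ _) (LinearMap.inr _ _ _) l +
  compBilin (LinearMap.snd _ _ _) (LinearMap.fst _ _ _) (LinearMap.inr _ _ _) (flipBilin r)

variable (br₁ : ConformalBilin k Q₁ Q₁ Q₁) (br₂ : ConformalBilin k Q₂ Q₂ Q₂)
  (l r : ConformalBilin k Q₁ Q₂ Q₂) (φ ψ : ConformalBilin k Q₂ Q₁ Q₁)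

theorem ev_bowtie (s : k) (u v : Q₁ × Q₂) :
    ev (bowtie br₁ br₂ l r φ ψ) s u v =
      (ev br₁ s u.1 v.1 + ev φ s u.2 v.1 + evD ψ (-s) v.2 u.1,
        ev br₂ s u.2 v.2 + ev l s u.1 v.2 + evD r (-s) v.1 u.2) := by
  simp only [bowtie, ev_add, ev_compBilin, ev_flipBilin, LinearMap.fst_apply, LinearMap.snd_apply,
    LinearMap.inl_apply, LinearMap.inr_apply, Prod.mk_add_mk, add_zero, zero_add]

variable {br₁ br₂ l r φ ψ}

theorem IsMatchedPair.isLeibniz_bowtie (h : IsMatchedPair br₁ br₂ l r φ ψ) :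
    IsLeibniz (bowtie br₁ br₂ l r φ ψ) := by
  rintro s t ⟨a, x⟩ ⟨b, y⟩ ⟨c, z⟩
  refine Prod.ext ?_ ?_
  · have h₁ := h.leibniz₁ s t a b c
    have h₂ := h.cond₄ s t a b z
    have h₃ := h.cond₅ s t a c y
    -- The contribution of x, b, c is not itself one of the conditions. The Leibniz identities for
    -- (x,b,c) and (b,x,c) add up to the vanishing of [[x,b] + [b,x], c], so it follows from `cond₅`
    -- with the parameters exchanged and `cond₆`. In the same way (a,y,z) is obtained from
    -- `left_right` and `right_right`.
    have h₄ := h.cond₅ t s b c x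
    have h₅ := h.cond₆ s t b c x
    have h₆ := h.rep₂.left_left s t x y c
    have h₇ := h.rep₂.left_right s t x z b
    have h₈ := h.rep₂.left_right t s y z a
    have h₉ := h.rep₂.right_right t s y z a
    simp only [ev_bowtie, Prod.fst_add, ev_add_left, ev_add_right, evD_add_left, evD_add_right,
      neg_add', add_comm t s, show -t - s = -s - t by ring] at *
    linear_combination (norm := abel) h₁ + h₂ + h₃ - h₅ - h₄ + h₆ + h₇ - h₈ - h₉
  · have h₁ := h.leibniz₂ s t x y z
    have h₂ := h.cond₁ s t c x y
    have h₃ := h.cond₂ s t a y z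
    have h₄ := h.cond₂ t s b x z
    have h₅ := h.cond₃ s t b x z
    have h₆ := h.rep₁.left_left s t a b z
    have h₇ := h.rep₁.left_right s t a c y
    have h₈ := h.rep₁.left_right t s b c x
    have h₉ := h.rep₁.right_right t s b c x
    simp only [ev_bowtie, Prod.snd_add, ev_add_left, ev_add_right, evD_add_left, evD_add_right,
      neg_add', add_comm t s, show -t - s = -s - t by ring] at *
    linear_combination (norm := abel) h₁ + h₂ + h₃ + h₅ + h₆ + h₇ - h₈ - h₉

theorem isMatchedPair_of_isLeibniz_bowtie (h : IsLeibniz (bowtie br₁ br₂ l r φ ψ)) :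
    IsMatchedPair br₁ br₂ l r φ ψ := by
  have H : ∀ s t a b c x y z, _ ∧ _ := fun s t a b c x y z =>
    Prod.ext_iff.mp (h s t (a, x) (b, y) (c, z))
  simp only [ev_bowtie, Prod.fst_add, Prod.snd_add, neg_add'] at H
  constructor
  · intro s t a b c
    simpa using (H s t a b c 0 0 0).1
  · intro s t a b c
    simpa using (H s t 0 0 0 a b c).2
  · constructor
    · intro s t a b v
      simpa using (H s t a b 0 0 0 v).2
    · intro s t a b v
      simpa using (H s t a 0 b 0 v 0).2
    · intro s t a b v
      -- In the sum of the Leibniz identities for (a,v,b) and (v,a,b) the iterated brackets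
      -- [a,[v,b]] and [v,[a,b]] cancel, leaving [[a,v] + [v,a], b] = 0.
      have h₁ := (H s t a 0 b 0 v 0).2
      have h₂ := (H t s 0 a b v 0 0).2
      simp only [ev_zero_left, ev_zero_right, evD_zero_left, evD_zero_right, add_zero, zero_add,
        add_comm t s, show -t - s = -s - t by ring] at h₁ h₂
      linear_combination (norm := abel) -h₁ - h₂
  · constructor
    · intro s t a b v
      simpa using (H s t 0 0 v a b 0).1
    · intro s t a b v
      simpa using (H s t 0 v 0 a 0 b).1
    · intro s t a b v
      have h₁ := (H s t 0 v 0 a 0 b).1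
      have h₂ := (H t s v 0 0 0 a b).1
      simp only [ev_zero_left, ev_zero_right, evD_zero_left, evD_zero_right, add_zero, zero_add,
        add_comm t s, show -t - s = -s - t by ring] at h₁ h₂
      linear_combination (norm := abel) -h₁ - h₂
  · intro s t a x y
    have := (H s t 0 0 a x y 0).2
    simp only [ev_zero_left, ev_zero_right, evD_zero_left, evD_zero_right, add_zero,
      zero_add] at this
    linear_combination (norm := abel) this
  · intro s t a x y
    have := (H s t a 0 0 0 x y).2
    simp only [ev_zero_left, ev_zero_right, evD_zero_left, evD_zero_right, add_zero,
      zero_add] at this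
    linear_combination (norm := abel) this
  · intro s t a x y
    have := (H s t 0 a 0 x 0 y).2
    simp only [ev_zero_left, ev_zero_right, evD_zero_left, evD_zero_right, add_zero,
      zero_add] at this
    linear_combination (norm := abel) this
  · intro s t a b x
    have := (H s t a b 0 0 0 x).1
    simp only [ev_zero_left, ev_zero_right, evD_zero_left, evD_zero_right, add_zero,
      zero_add] at this
    linear_combination (norm := abel) this
  · intro s t a b x
    have := (H s t a 0 b 0 x 0).1
    simp only [ev_zero_left, ev_zero_right, evD_zero_left, evD_zero_right, add_zero,
      zero_add] at this
    linear_combination (norm := abel) this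
  · intro s t a b x
    -- The same cancellation, now for (x,a,b) and (a,x,b).
    have h₁ := (H s t 0 a b x 0 0).1
    have h₂ := (H t s a 0 b 0 x 0).1
    simp only [ev_zero_left, ev_zero_right, evD_zero_left, evD_zero_right, add_zero, zero_add,
      add_comm t s] at h₁ h₂
    linear_combination (norm := abel) -h₁ - h₂

/-- Matched pairs are the same as Leibniz structures on the direct sum. -/
theorem isMatchedPair_iff :
    IsMatchedPair br₁ br₂ l r φ ψ ↔ IsLeibniz (bowtie br₁ br₂ l r φ ψ) :=
  ⟨IsMatchedPair.isLeibniz_bowtie, isMatchedPair_of_isLeibniz_bowtie⟩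

end MatchedPairs

/-! ### Invariant forms and the symmetries of the Leibniz defect -/

section InvariantForms

variable {k : Type*} [Field k]
variable {E : Type*} [AddCommGroup E] [Module k E] [Module k[X] E] [IsScalarTower k k[X] E]

/-- The value of a conformal bilinear form at a scalar. -/
def formEv (B : ↥(conformalForm k E)) (s : k) : E →ₗ[k] E →ₗ[k] k := B.1.compr₂ (leval s)

theorem formEv_apply (B : ↥(conformalForm k E)) (s : k) (u v : E) :
    formEv B s u v = (B.1 u v).eval s := rfl

theorem formEv_X_smul_right (B : ↥(conformalForm k E)) (s : k) (u v : E) :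
    formEv B s u ((X : k[X]) • v) = s * formEv B s u v := by
  simp [formEv_apply, B.2.2]

theorem formEv_evD_right (B : ↥(conformalForm k E)) {A C : Type*} [AddCommGroup A] [Module k A]
    [Module k[X] A] [IsScalarTower k k[X] A] [AddCommGroup C] [Module k C] [Module k[X] C]
    [IsScalarTower k k[X] C] (g : ConformalBilin k A C E) (s c : k) (v : E) (a : A) (b : C) :
    formEv B s v (evD g c a b) = formEv B s v (ev g (c - s) a b) :=
  map_evD g c (formEv B s v) s (fun f => by simp [formEv_X_smul_right]) a b

variable (br : ConformalBilin k E E E) (B : ↥(conformalForm k E))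

/-- The trilinear function `B_s(x, [y_t z])`.  Elements of `E` carry the scalar by which `-∂` acts
on them, so that the function is meaningful when the three scalars add up to zero. -/
def tri (x y z : E × k) : k := formEv B x.2 x.1 (ev br y.2 y.1 z.1)

/-- The bracket of elements with attached scalars. -/
def brk (y z : E × k) : E × k := (ev br y.2 y.1 z.1, y.2 + z.2)

/-- Skew-symmetry of a conformal form, through its values. -/
def IsSkewForm : Prop := ∀ s u v, formEv B s u v = -formEv B (-s) v u

/-- Invariance of a conformal form, through its values. -/
def IsInvariantForm : Prop :=
  ∀ x y z : E × k, x.2 + y.2 + z.2 = 0 → tri br B x y z + tri br B y x z + tri br B y z x = 0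

/-- The Leibniz identity for `a`, `b`, `c`, paired with `d`. -/
def jac (d a b c : E × k) : k :=
  tri br B d a (brk br b c) - tri br B d (brk br a b) c - tri br B d b (brk br a c)

variable {br B}

/-- The scalar attached to c is forced to be -m-l. Paired with b at the scalar l, the operator -m-∂
acts as exactly this number, so the reflected bracket is an ordinary value of `tri`. -/
theorem isInvariantForm_iff (hskew : IsSkewForm B) :
    IsInvariantForm br B ↔ ∀ (l m : k) (a b c : E),
      (B.1 a (ev br l b c)).eval m = (B.1 (ev br m a c + evD br (-m) c a) b).eval (-l) := by
  simp only [← formEv_apply]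
  have key (l m : k) (a b c : E) : formEv B (-l) (ev br m a c + evD br (-m) c a) b =
      -(tri br B (b, l) (a, m) (c, -m - l) + tri br B (b, l) (c, -m - l) (a, m)) := by
    rw [hskew, neg_neg, map_add, formEv_evD_right]
    rfl
  constructor
  · intro h l m a b c
    have := h (a, m) (b, l) (c, -m - l) (by ring)
    rw [key]
    exact eq_neg_of_add_eq_zero_left (by rw [← this]; simp [tri]; ring)
  · rintro h ⟨a, m⟩ ⟨b, l⟩ ⟨c, n⟩ hs
    obtain rfl : n = -m - l := by linear_combination hs
    have := h l m a b c
    rw [key] at this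
    have h' : tri br B (a, m) (b, l) (c, -m - l) = formEv B m a (ev br l b c) := rfl
    rw [h', this]; ring

section Identities

variable (hskew : IsSkewForm B) (hinv : IsInvariantForm br B)
include hinv

/-- The invariance relations for (x,z,y) and (z,x,y) have two of their three terms in common. Given
this symmetry, invariance says that the values with x, y and z in the middle sum to zero. -/
theorem tri_swap (x y z : E × k) (h : x.2 + y.2 + z.2 = 0) : tri br B x y z = tri br B z y x := by
  have h₁ := hinv x z y (by rw [← h]; ring)
  have h₂ := hinv z x y (by rw [← h]; ring)
  linear_combination h₂ - h₁

/-- Used to write the term of the Leibniz identity that has a bracket in its left argument through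
right-nested brackets. -/
theorem tri_brk_middle (x a b z : E × k) (h : x.2 + a.2 + b.2 + z.2 = 0) :
    tri br B x (brk br a b) z = -tri br B z x (brk br a b) - tri br B x z (brk br a b) := by
  have h₀ : x.2 + (brk br a b).2 + z.2 = 0 := by rw [← h]; simp only [brk]; ring
  have h₁ := hinv x (brk br a b) z h₀
  have h₂ := tri_swap hinv z x (brk br a b) (by rw [← h₀]; ring)
  have h₃ := tri_swap hinv x z (brk br a b) (by rw [← h₀]; ring)
  linear_combination h₁ + h₂ + h₃

include hskew

omit hinv in
theorem tri_brk_left (a b c d : E × k) (h : a.2 + b.2 + c.2 + d.2 = 0) :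
    tri br B (brk br a b) c d = -tri br B (brk br c d) a b := by
  simp only [tri, brk]
  rw [hskew, show -(a.2 + b.2) = c.2 + d.2 by linear_combination -h]

/-- Reversing the word d, a, b, c changes the sign of B(d,[a,[b,c]]): exchange the outer arguments,
use skew-symmetry on B([b,c],[a,d]), and exchange again. -/
theorem tri_brk_reverse (d a b c : E × k) (h : d.2 + a.2 + b.2 + c.2 = 0) :
    tri br B d a (brk br b c) = -tri br B c b (brk br a d) := by
  rw [tri_swap hinv d a _ (by rw [← h]; simp only [brk]; ring),
    tri_brk_left hskew b c a d (by rw [← h]; ring),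
    tri_swap hinv c b _ (by rw [← h]; simp only [brk]; ring)]

omit hskew in
-- All terms are now right-nested words, and `tri_brk_reverse` is the only relation needed to
-- compare them.
theorem jac_eq (d a b c : E × k) (h : d.2 + a.2 + b.2 + c.2 = 0) :
    jac br B d a b c = tri br B d a (brk br b c) + tri br B c d (brk br a b) +
      tri br B d c (brk br a b) - tri br B d b (brk br a c) := by
  rw [jac, tri_brk_middle hinv d a b c h]
  ring

/-- In the form of `jac_eq`, the two middle terms are exchanged with one another, and word reversal
matches the first term with the last. -/
theorem jac_swap_ends (a b c d : E × k) (h : a.2 + b.2 + c.2 + d.2 = 0) :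
    jac br B a b c d = jac br B d b c a := by
  rw [jac_eq hinv _ _ _ _ h, jac_eq hinv d b c a (by rw [← h]; ring)]
  have h₁ := tri_brk_reverse hskew hinv a b c d h
  have h₂ := tri_brk_reverse hskew hinv a c b d (by rw [← h]; ring)
  linear_combination h₁ - h₂

/-- Together with `jac_swap_ends` and `jac_second`, this brings an element d from any slot to the
front. It is used when d comes from a different summand than some of the others. -/
theorem jac_third (a b c d : E × k) (h : a.2 + b.2 + c.2 + d.2 = 0) :
    jac br B a b d c = -jac br B d b a c - jac br B d b c a := by
  rw [jac_eq hinv a b d c (by rw [← h]; ring), jac_eq hinv d b a c (by rw [← h]; ring),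
    jac_eq hinv d b c a (by rw [← h]; ring)]
  have h₁ := tri_brk_reverse hskew hinv a b d c (by rw [← h]; ring)
  have h₂ := tri_brk_reverse hskew hinv c a b d (by rw [← h]; ring)
  have h₃ := tri_brk_reverse hskew hinv d b c a (by rw [← h]; ring)
  linear_combination h₁ + h₂ + h₃

theorem jac_second (a b c d : E × k) (h : a.2 + b.2 + c.2 + d.2 = 0) :
    jac br B a d b c =
      -jac br B d a c b + jac br B d b a c + jac br B d b c a - jac br B d c a b := by
  rw [jac_eq hinv a d b c (by rw [← h]; ring), jac_eq hinv d a c b (by rw [← h]; ring),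
    jac_eq hinv d b a c (by rw [← h]; ring), jac_eq hinv d b c a (by rw [← h]; ring),
    jac_eq hinv d c a b (by rw [← h]; ring)]
  have h₁ := tri_brk_reverse hskew hinv c a d b (by rw [← h]; ring)
  have h₂ := tri_brk_reverse hskew hinv a c d b (by rw [← h]; ring)
  have h₃ := tri_brk_reverse hskew hinv a b d c (by rw [← h]; ring)
  linear_combination h₁ + h₂ - h₃

/-- `jac_second` solved for the term with d and a at the two ends. When d, a lie in one summand and
b, c in the other, the remaining terms all have pattern LLRR or LRLR. -/
theorem jac_ends (a b c d : E × k) (h : a.2 + b.2 + c.2 + d.2 = 0) :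
    jac br B d b c a =
      jac br B d a c b - jac br B d b a c + jac br B d c a b + jac br B a d b c := by
  linear_combination -jac_second hskew hinv a b c d h

end Identities

end InvariantForms

/-! ### Reduction of the Leibniz identity on a direct sum -/

section DirectSums

variable {k : Type*} [Field k]
variable {E : Type*} [AddCommGroup E] [Module k E] [Module k[X] E] [IsScalarTower k k[X] E]

theorem isLeibniz_iff_jac {br : ConformalBilin k E E E} {B : ↥(conformalForm k E)}
    (hB : ∀ w, (∀ s u, formEv B s u w = 0) → w = 0) :
    IsLeibniz br ↔ ∀ d a b c : E × k, d.2 + a.2 + b.2 + c.2 = 0 → jac br B d a b c = 0 := by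
  constructor
  · rintro h ⟨d, p⟩ ⟨a, l⟩ ⟨b, m⟩ ⟨c, n⟩ -
    simp only [jac, tri, brk, h l m a b c, map_add]
    ring
  · intro h l m a b c
    rw [← sub_eq_zero]
    refine hB _ fun s u => ?_
    -- The scalar attached to the last element does not enter the value of `jac`, so it is free to
    -- make the sum zero.
    have := h (u, s) (a, l) (b, m) (c, -s - l - m) (by ring)
    simp only [jac, tri, brk] at this
    rw [map_sub, map_add, ← this]
    ring

section Additivity

variable (br : ConformalBilin k E E E) (B : ↥(conformalForm k E)) (x y z : E × k) (u v : E) (s : k)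

theorem jac_add₁ : jac br B (u + v, s) x y z = jac br B (u, s) x y z + jac br B (v, s) x y z := by
  simp only [jac, tri, brk, map_add, LinearMap.add_apply]; ring

theorem jac_add₂ : jac br B x (u + v, s) y z = jac br B x (u, s) y z + jac br B x (v, s) y z := by
  simp only [jac, tri, brk, map_add, ev_add_left, ev_add_right]; ring

theorem jac_add₃ : jac br B x y (u + v, s) z = jac br B x y (u, s) z + jac br B x y (v, s) z := by
  simp only [jac, tri, brk, map_add, ev_add_left, ev_add_right]; ring

theorem jac_add₄ : jac br B x y z (u + v, s) = jac br B x y z (u, s) + jac br B x y z (v, s) := by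
  simp only [jac, tri, brk, map_add, ev_add_right]; ring

theorem tri_add₁ : tri br B (u + v, s) x y = tri br B (u, s) x y + tri br B (v, s) x y := by
  simp only [tri, map_add, LinearMap.add_apply]

theorem tri_add₂ : tri br B x (u + v, s) y = tri br B x (u, s) y + tri br B x (v, s) y := by
  simp only [tri, map_add, ev_add_left]

theorem tri_add₃ : tri br B x y (u + v, s) = tri br B x y (u, s) + tri br B x y (v, s) := by
  simp only [tri, map_add, ev_add_right]

end Additivity

variable {Q₁ : Type*} [AddCommGroup Q₁] [Module k Q₁] [Module k[X] Q₁] [IsScalarTower k k[X] Q₁]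
variable {Q₂ : Type*} [AddCommGroup Q₂] [Module k Q₂] [Module k[X] Q₂] [IsScalarTower k k[X] Q₂]

/-- The inclusion of the first summand, for elements with attached scalars. -/
def onLeft (Q₂ : Type*) [AddCommGroup Q₂] (a : Q₁ × k) : (Q₁ × Q₂) × k := ((a.1, 0), a.2)

/-- The inclusion of the second summand, for elements with attached scalars. -/
def onRight (Q₁ : Type*) [AddCommGroup Q₁] (a : Q₂ × k) : (Q₁ × Q₂) × k := ((0, a.1), a.2)

@[simp] theorem onLeft_snd (a : Q₁ × k) : (onLeft Q₂ a).2 = a.2 := rfl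

@[simp] theorem onRight_snd (a : Q₂ × k) : (onRight Q₁ a).2 = a.2 := rfl

/-- Lets identities that are additive in each argument be checked with every argument in one of the
summands, at unchanged scalars. -/
theorem forall_of_onLeft_onRight {p : (Q₁ × Q₂) × k → Prop} {s : k}
    (hadd : ∀ u v, p (u, s) → p (v, s) → p (u + v, s))
    (hl : ∀ a : Q₁ × k, a.2 = s → p (onLeft Q₂ a)) (hr : ∀ a : Q₂ × k, a.2 = s → p (onRight Q₁ a))
    (u : Q₁ × Q₂) : p (u, s) := by
  have h := hadd (u.1, 0) (0, u.2) (hl (u.1, s) rfl) (hr (u.2, s) rfl)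
  simpa using h

/-- The Leibniz identity for an invariant form on a direct sum, reduced to six kinds of
quadruples of elements of the summands. -/
theorem jac_eq_zero_of_onLeft_onRight
    {br : ConformalBilin k (Q₁ × Q₂) (Q₁ × Q₂) (Q₁ × Q₂)} {B : ↥(conformalForm k (Q₁ × Q₂))}
    (hskew : IsSkewForm B) (hinv : IsInvariantForm br B)
    (hLLLL : ∀ d a b c : Q₁ × k, d.2 + a.2 + b.2 + c.2 = 0 →
      jac br B (onLeft Q₂ d) (onLeft Q₂ a) (onLeft Q₂ b) (onLeft Q₂ c) = 0)
    (hRRRR : ∀ d a b c : Q₂ × k, d.2 + a.2 + b.2 + c.2 = 0 →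
      jac br B (onRight Q₁ d) (onRight Q₁ a) (onRight Q₁ b) (onRight Q₁ c) = 0)
    (hRLLL : ∀ (d : Q₂ × k) (a b c : Q₁ × k), d.2 + a.2 + b.2 + c.2 = 0 →
      jac br B (onRight Q₁ d) (onLeft Q₂ a) (onLeft Q₂ b) (onLeft Q₂ c) = 0)
    (hLRRR : ∀ (d : Q₁ × k) (a b c : Q₂ × k), d.2 + a.2 + b.2 + c.2 = 0 →
      jac br B (onLeft Q₂ d) (onRight Q₁ a) (onRight Q₁ b) (onRight Q₁ c) = 0)
    (hLLRR : ∀ (d a : Q₁ × k) (b c : Q₂ × k), d.2 + a.2 + b.2 + c.2 = 0 →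
      jac br B (onLeft Q₂ d) (onLeft Q₂ a) (onRight Q₁ b) (onRight Q₁ c) = 0)
    (hLRLR : ∀ (d b : Q₁ × k) (a c : Q₂ × k), d.2 + a.2 + b.2 + c.2 = 0 →
      jac br B (onLeft Q₂ d) (onRight Q₁ a) (onLeft Q₂ b) (onRight Q₁ c) = 0)
    (d a b c : (Q₁ × Q₂) × k) (h : d.2 + a.2 + b.2 + c.2 = 0) : jac br B d a b c = 0 := by
  obtain ⟨d, p⟩ := d
  obtain ⟨a, l⟩ := a
  obtain ⟨b, m⟩ := b
  obtain ⟨c, n⟩ := c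
  simp only at h
  have ends := jac_swap_ends hskew hinv
  have third := jac_third hskew hinv
  have second := jac_second hskew hinv
  have both := jac_ends hskew hinv
  -- Splitting all four arguments gives sixteen goals, in the order LLLL, LLLR, LLRL, LLRR and so on
  -- up to RRRR.
  refine forall_of_onLeft_onRight (p := fun d => jac br B d (a, l) (b, m) (c, n) = 0)
    (fun u v hu hv => by rw [jac_add₁, hu, hv, add_zero]) (fun d hd => ?_) (fun d hd => ?_) d <;>
  refine forall_of_onLeft_onRight (p := fun a => jac br B _ a (b, m) (c, n) = 0)
    (fun u v hu hv => by rw [jac_add₂, hu, hv, add_zero]) (fun a ha => ?_) (fun a ha => ?_) a <;>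
  refine forall_of_onLeft_onRight (p := fun b => jac br B _ _ b (c, n) = 0)
    (fun u v hu hv => by rw [jac_add₃, hu, hv, add_zero]) (fun b hb => ?_) (fun b hb => ?_) b <;>
  refine forall_of_onLeft_onRight (p := fun c => jac br B _ _ _ c = 0)
    (fun u v hu hv => by rw [jac_add₄, hu, hv, add_zero]) (fun c hc => ?_) (fun c hc => ?_) c <;>
  subst hd ha hb hc
  · exact hLLLL d a b c h
  · rw [ends _ _ _ _ h]
    exact hRLLL _ _ _ _ (by rw [← h]; ring)
  · rw [third _ _ _ _ (by simpa [add_right_comm] using h),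
      hRLLL _ _ _ _ (by rw [← h]; ring), hRLLL _ _ _ _ (by rw [← h]; ring)]
    ring
  · exact hLLRR d a b c h
  · rw [second _ _ _ _ (by simp only [onLeft_snd, onRight_snd]; linear_combination h),
      hRLLL _ _ _ _ (by rw [← h]; ring), hRLLL _ _ _ _ (by rw [← h]; ring),
      hRLLL _ _ _ _ (by rw [← h]; ring), hRLLL _ _ _ _ (by rw [← h]; ring)]
    ring
  · exact hLRLR d b a c h
  -- Pattern LRRL. Exchanging the ends maps this pattern to itself, so it is expanded by `jac_ends`.
  · rw [both _ _ _ _ (by rw [← h]; simp only [onLeft_snd, onRight_snd]; ring),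
      hLLRR _ _ _ _ (by rw [← h]; ring), hLRLR _ _ _ _ (by rw [← h]; ring),
      hLRLR _ _ _ _ (by rw [← h]; ring), hLLRR _ _ _ _ (by rw [← h]; ring)]
    ring
  · exact hLRRR d a b c h
  · exact hRLLL d a b c h
  · rw [third _ _ _ _ (by simp only [onLeft_snd, onRight_snd]; linear_combination h),
      hLLRR _ _ _ _ (by rw [← h]; ring), hLLRR _ _ _ _ (by rw [← h]; ring)]
    ring
  · rw [ends _ _ _ _ h]
    exact hLLRR _ _ _ _ (by rw [← h]; ring)
  · rw [second _ _ _ _ (by simp only [onLeft_snd, onRight_snd]; linear_combination h),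
      hLRRR _ _ _ _ (by rw [← h]; ring), hLRRR _ _ _ _ (by rw [← h]; ring),
      hLRRR _ _ _ _ (by rw [← h]; ring), hLRRR _ _ _ _ (by rw [← h]; ring)]
    ring
  · rw [ends _ _ _ _ h]
    exact hLRLR _ _ _ _ (by rw [← h]; ring)
  · rw [third _ _ _ _ (by simp only [onLeft_snd, onRight_snd]; linear_combination h),
      hLRRR _ _ _ _ (by rw [← h]; ring), hLRRR _ _ _ _ (by rw [← h]; ring)]
    ring
  · rw [ends _ _ _ _ h]
    exact hLRRR _ _ _ _ (by rw [← h]; ring)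
  · exact hRRRR d a b c h

end DirectSums

/-! ### The standard form and the double of two brackets -/

section StandardForm

variable {k : Type*} [Field k]
variable {Q : Type*} [AddCommGroup Q] [Module k Q] [Module k[X] Q] [IsScalarTower k k[X] Q]

theorem formEv_standardForm (s : k) (u v : Q × ConformalDual k Q) :
    formEv (standardForm k Q) s u v = pairEv s u.2 v.1 - pairEv (-s) v.2 u.1 := by
  simp [formEv_apply, standardForm, pairEv_apply]

theorem standardForm_isSkewForm : IsSkewForm (standardForm k Q) := fun s u v => by
  rw [formEv_standardForm, formEv_standardForm, neg_neg]; ring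

theorem standardForm_skew (u v : Q × ConformalDual k Q) :
    (standardForm k Q).1 u v = -((standardForm k Q).1 v u).comp (-X) := by
  simp only [standardForm, LinearMap.mk₂_apply, sub_comp, comp_neg_comp_neg]
  ring

theorem standardForm_separatingRight [Infinite k] [Module.Free k[X] Q] (w : Q × ConformalDual k Q)
    (h : ∀ s u, formEv (standardForm k Q) s u w = 0) : w = 0 := by
  refine Prod.ext (eq_zero_of_pairEv (k := k) _ fun s f => ?_) (pairEv_ext fun s u => ?_)
  · simpa [formEv_standardForm] using h s (0, f)
  · simpa [formEv_standardForm] using h (-s) (u, 0)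

theorem standardForm_nondegenerate [Module.Finite k[X] Q] [Module.Free k[X] Q] :
    Function.Bijective (formToDual (standardForm k Q)) := by
  have hpair (u v : Q × ConformalDual k Q) : pairing k _ (formToDual (standardForm k Q) u) v =
      pairing k Q u.2 v.1 - (pairing k Q v.2 u.1).comp (-X) := rfl
  constructor
  · intro u v h
    have h' (w : Q × ConformalDual k Q) := congrArg (fun F => pairing k _ F w) h
    simp only [hpair] at h'
    refine Prod.ext ((doubleDual_bijective (k := k)).1 (dual_ext fun f => ?_)) (dual_ext fun a => ?_)
    · rw [pairing_doubleDual, pairing_doubleDual]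
      simpa using h' (0, f)
    · simpa using h' (a, 0)
  · intro F
    let f : ConformalDual k Q := mkDual (pairing k _ F ∘ₗ LinearMap.inl k Q (ConformalDual k Q))
      fun u => by
        have := pairing_X_smul_right F (u, 0)
        simpa using this
    let G : ConformalDual k (ConformalDual k Q) :=
      mkDual (pairing k _ F ∘ₗ LinearMap.inr k Q (ConformalDual k Q)) fun u => by
        have := pairing_X_smul_right F (0, u)
        simpa using this
    obtain ⟨a, ha⟩ := doubleDual_bijective.2 G
    -- The minus sign of a compensates the one in front of the second term of the form.
    refine ⟨(-a, f), dual_ext fun v => ?_⟩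
    have h₁ : pairing k Q f v.1 = pairing k _ F (v.1, 0) := rfl
    have h₂ : (pairing k Q v.2 a).comp (-X) = pairing k _ F (0, v.2) := by
      rw [← pairing_doubleDual, ha]; rfl
    rw [hpair]
    simp only [map_neg, neg_comp, sub_neg_eq_add]
    rw [h₁, h₂, ← map_add]
    simp

variable [Module.Finite k[X] Q] [Module.Free k[X] Q]

/-- The `λ`-bracket on `Q ⊕ Q^{*c}` for which the standard form is invariant. -/
def doubleBracket (br : ConformalBilin k Q Q Q)
    (br' : ConformalBilin k (ConformalDual k Q) (ConformalDual k Q) (ConformalDual k Q)) :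
    ConformalBilin k (Q × ConformalDual k Q) (Q × ConformalDual k Q) (Q × ConformalDual k Q) :=
  bowtie br br' (Lstar br) (-Lstar br - Rstar br) (calLstar br') (-calLstar br' - calRstar br')

variable (br : ConformalBilin k Q Q Q)
  (br' : ConformalBilin k (ConformalDual k Q) (ConformalDual k Q) (ConformalDual k Q))

theorem doubleBracket_extends : ExtendsBrackets (doubleBracket br br') br br' := by
  refine ⟨fun a b => ?_, fun f g => ?_⟩
  · simp [doubleBracket, bowtie, compBilin_apply]; rfl
  · simp [doubleBracket, bowtie, compBilin_apply]; rfl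

variable {br br'}

theorem ExtendsBrackets.brk_onLeft {brE} (h : ExtendsBrackets brE br br') (a b : Q × k) :
    brk brE (onLeft (ConformalDual k Q) a) (onLeft _ b) = onLeft _ (brk br a b) := by
  refine Prod.ext ?_ rfl
  simp only [brk, onLeft, ev, h.1]
  exact PolynomialModule.eval_map k (LinearMap.inl k Q (ConformalDual k Q)) _ _

theorem ExtendsBrackets.brk_onRight {brE} (h : ExtendsBrackets brE br br')
    (f g : ConformalDual k Q × k) : brk brE (onRight Q f) (onRight Q g) = onRight Q (brk br' f g) := by
  refine Prod.ext ?_ rfl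
  simp only [brk, onRight, ev, h.2]
  exact PolynomialModule.eval_map k (LinearMap.inr k Q (ConformalDual k Q)) _ _

theorem tri_eq_formEv_brk {E : Type*} [AddCommGroup E] [Module k E] [Module k[X] E]
    [IsScalarTower k k[X] E] (brE : ConformalBilin k E E E) (B : ↥(conformalForm k E))
    (x y z : E × k) : tri brE B x y z = formEv B x.2 x.1 (brk brE y z).1 := rfl

/-- There is at most one extension of the brackets for which the standard form is invariant. -/
theorem ExtendsBrackets.ev_eq [Infinite k] {brE brE'} (h : ExtendsBrackets brE br br')
    (h' : ExtendsBrackets brE' br br') (hinv : IsInvariantForm brE (standardForm k Q))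
    (hinv' : IsInvariantForm brE' (standardForm k Q)) (s : k) (u v : Q × ConformalDual k Q) :
    ev brE s u v = ev brE' s u v := by
  have key (x y z : (Q × ConformalDual k Q) × k) (hs : x.2 + y.2 + z.2 = 0) :
      tri brE (standardForm k Q) x y z = tri brE' (standardForm k Q) x y z := by
    have hl (x : (Q × ConformalDual k Q) × k) (a b : Q × k) :
        tri brE (standardForm k Q) x (onLeft _ a) (onLeft _ b) =
          tri brE' (standardForm k Q) x (onLeft _ a) (onLeft _ b) := by
      rw [tri_eq_formEv_brk, tri_eq_formEv_brk, h.brk_onLeft, h'.brk_onLeft]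
    have hr (x : (Q × ConformalDual k Q) × k) (a b : ConformalDual k Q × k) :
        tri brE (standardForm k Q) x (onRight _ a) (onRight _ b) =
          tri brE' (standardForm k Q) x (onRight _ a) (onRight _ b) := by
      rw [tri_eq_formEv_brk, tri_eq_formEv_brk, h.brk_onRight, h'.brk_onRight]
    have swap := tri_swap hinv
    have swap' := tri_swap hinv'
    -- This serves the case where the two elements of the same summand are in the outer slots: the
    -- vanishing sum over middle arguments replaces the value by two others in which these elements
    -- are adjacent.
    have middle (x y z : (Q × ConformalDual k Q) × k) (hs : x.2 + y.2 + z.2 = 0)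
        (h₁ : tri brE (standardForm k Q) x z y = tri brE' (standardForm k Q) x z y)
        (h₂ : tri brE (standardForm k Q) z x y = tri brE' (standardForm k Q) z x y) :
        tri brE (standardForm k Q) x y z = tri brE' (standardForm k Q) x y z := by
      have e := hinv x z y (by rw [← hs]; ring)
      have e' := hinv' x z y (by rw [← hs]; ring)
      rw [swap x y z hs, swap' x y z hs]
      linear_combination e - e' - h₁ - h₂
    obtain ⟨x, l⟩ := x
    obtain ⟨y, m⟩ := y
    obtain ⟨z, n⟩ := z
    simp only at hs
    refine forall_of_onLeft_onRight (p := fun x => tri brE _ x (y, m) (z, n) = tri brE' _ x _ _)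
      (fun u v hu hv => by rw [tri_add₁, tri_add₁, hu, hv]) (fun x hx => ?_) (fun x hx => ?_) x <;>
    refine forall_of_onLeft_onRight (p := fun y => tri brE _ _ y (z, n) = tri brE' _ _ y _)
      (fun u v hu hv => by rw [tri_add₂, tri_add₂, hu, hv]) (fun y hy => ?_) (fun y hy => ?_) y <;>
    refine forall_of_onLeft_onRight (p := fun z => tri brE _ _ _ z = tri brE' _ _ _ z)
      (fun u v hu hv => by rw [tri_add₃, tri_add₃, hu, hv]) (fun z hz => ?_) (fun z hz => ?_) z <;>
    subst hx hy hz
    · exact hl _ _ _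
    · rw [swap _ _ _ hs, swap' _ _ _ hs]; exact hl _ _ _
    · refine middle _ _ _ hs ?_ ?_
      · rw [swap _ _ _ (by simp only [onLeft_snd, onRight_snd]; linear_combination hs),
          swap' _ _ _ (by simp only [onLeft_snd, onRight_snd]; linear_combination hs)]
        exact hl _ _ _
      · rw [swap _ _ _ (by simp only [onLeft_snd, onRight_snd]; linear_combination hs),
          swap' _ _ _ (by simp only [onLeft_snd, onRight_snd]; linear_combination hs)]
        exact hl _ _ _
    · exact hr _ _ _
    · exact hl _ _ _
    · refine middle _ _ _ hs ?_ ?_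
      · rw [swap _ _ _ (by simp only [onLeft_snd, onRight_snd]; linear_combination hs),
          swap' _ _ _ (by simp only [onLeft_snd, onRight_snd]; linear_combination hs)]
        exact hr _ _ _
      · rw [swap _ _ _ (by simp only [onLeft_snd, onRight_snd]; linear_combination hs),
          swap' _ _ _ (by simp only [onLeft_snd, onRight_snd]; linear_combination hs)]
        exact hr _ _ _
    · rw [swap _ _ _ hs, swap' _ _ _ hs]; exact hr _ _ _
    · exact hr _ _ _
  rw [← sub_eq_zero]
  refine standardForm_separatingRight _ fun t w => ?_
  rw [map_sub, sub_eq_zero]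
  exact key (w, t) (u, s) (v, -t - s) (by ring)

/-! ### Values of the trilinear function of the double -/

section Values

local notation "Br" => doubleBracket br br'
local notation "Bf" => standardForm k Q
local notation "iL" => onLeft (ConformalDual k Q)
local notation "iR" => onRight Q

theorem tri_LLL (a b c : Q × k) : tri Br Bf (iL a) (iL b) (iL c) = 0 := by
  rw [tri_eq_formEv_brk, (doubleBracket_extends br br').brk_onLeft, formEv_standardForm]
  simp [onLeft]

theorem tri_RRR (a b c : ConformalDual k Q × k) : tri Br Bf (iR a) (iR b) (iR c) = 0 := by
  rw [tri_eq_formEv_brk, (doubleBracket_extends br br').brk_onRight, formEv_standardForm]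
  simp [onRight]

theorem tri_RLL (f : ConformalDual k Q × k) (a b : Q × k) :
    tri Br Bf (iR f) (iL a) (iL b) = pairEv f.2 f.1 (ev br a.2 a.1 b.1) := by
  rw [tri_eq_formEv_brk, (doubleBracket_extends br br').brk_onLeft, formEv_standardForm]
  simp [onLeft, onRight, brk]

theorem tri_LRR (a : Q × k) (f g : ConformalDual k Q × k) :
    tri Br Bf (iL a) (iR f) (iR g) = -pairEv (-a.2) (ev br' f.2 f.1 g.1) a.1 := by
  rw [tri_eq_formEv_brk, (doubleBracket_extends br br').brk_onRight, formEv_standardForm]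
  simp [onLeft, onRight, brk]

theorem pairEv_Lstar (s t : k) (a u : Q) (f : ConformalDual k Q) :
    pairEv t (ev (Lstar br) s a f) u = -pairEv (t - s) f (ev br s a u) :=
  pairEv_dualAction br s t a f u

/-- The reflected parameter -s-∂ is evaluated under a pairing at t - s, and -s-(t-s) = -t. -/
theorem pairEv_Rstar (s t : k) (a u : Q) (f : ConformalDual k Q) :
    pairEv t (ev (Rstar br) s a f) u = -pairEv (t - s) f (ev br (-t) u a) := by
  have h : pairEv t (ev (Rstar br) s a f) u = -pairEv (t - s) f (ev (rightMul br) s a u) :=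
    pairEv_dualAction (rightMul br) s t a f u
  rw [h, ev_rightMul, pairEv_evD_right]
  congr 4; ring

theorem pairEv_calLstar (s t : k) (a : Q) (f g : ConformalDual k Q) :
    pairEv t g (ev (calLstar br') s f a) = -pairEv (t + s) (ev br' s f g) a :=
  pairEv_transport_dualAction br' s t f g a

/-- Here -s-∂ is applied to an element of the dual that is paired at t + s, so that -∂ contributes t
+ s and the parameter is t. -/
theorem pairEv_calRstar (s t : k) (a : Q) (f g : ConformalDual k Q) :
    pairEv t g (ev (calRstar br') s f a) = -pairEv (t + s) (ev br' t g f) a := by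
  have h : pairEv t g (ev (calRstar br') s f a) = -pairEv (t + s) (ev (rightMul br') s f g) a :=
    pairEv_transport_dualAction (rightMul br') s t f g a
  rw [h, ev_rightMul, pairEv_evD_left]
  congr 4; ring

theorem tri_LLR (a b : Q × k) (f : ConformalDual k Q × k) (h : a.2 + b.2 + f.2 = 0) :
    tri Br Bf (iL a) (iL b) (iR f) = pairEv f.2 f.1 (ev br b.2 b.1 a.1) := by
  simp only [tri, doubleBracket, ev_bowtie, formEv_standardForm, onLeft, onRight]
  simp only [map_zero, LinearMap.zero_apply, ev_zero_left, evD_zero_left, zero_add, add_zero,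
    zero_sub, pairEv_Lstar, neg_neg]
  rw [show -a.2 - b.2 = f.2 by linear_combination -h]

/-- The right action is minus the sum of the two dual actions precisely so that this value cancels
those of `tri_LLR` for both orders of a and b, as invariance demands. `tri_RLR` plays the same part
for the dual. -/
theorem tri_LRL (a b : Q × k) (f : ConformalDual k Q × k) (h : a.2 + f.2 + b.2 = 0) :
    tri Br Bf (iL a) (iR f) (iL b) =
      -pairEv f.2 f.1 (ev br b.2 b.1 a.1) - pairEv f.2 f.1 (ev br a.2 a.1 b.1) := by
  simp only [tri, doubleBracket, ev_bowtie, formEv_standardForm, onLeft, onRight]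
  simp only [map_zero, LinearMap.zero_apply, ev_zero_left, ev_zero_right, evD_zero_right, zero_add,
    zero_sub, pairEv_evD_left]
  simp only [ev_sub, ev_neg, map_sub, map_neg, LinearMap.sub_apply, LinearMap.neg_apply,
    pairEv_Lstar, pairEv_Rstar, neg_neg]
  rw [show -f.2 + -a.2 = b.2 by linear_combination -h,
    show -a.2 - b.2 = f.2 by linear_combination -h]
  ring

theorem tri_RRL (f g : ConformalDual k Q × k) (a : Q × k) (h : f.2 + g.2 + a.2 = 0) :
    tri Br Bf (iR f) (iR g) (iL a) = -pairEv (-a.2) (ev br' g.2 g.1 f.1) a.1 := by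
  simp only [tri, doubleBracket, ev_bowtie, formEv_standardForm, onLeft, onRight]
  simp only [map_zero, ev_zero_left, evD_zero_left, zero_add, add_zero,
    sub_zero, pairEv_calLstar]
  rw [show f.2 + g.2 = -a.2 by linear_combination h]

theorem tri_RLR (f g : ConformalDual k Q × k) (a : Q × k) (h : f.2 + a.2 + g.2 = 0) :
    tri Br Bf (iR f) (iL a) (iR g) =
      pairEv (-a.2) (ev br' g.2 g.1 f.1) a.1 + pairEv (-a.2) (ev br' f.2 f.1 g.1) a.1 := by
  simp only [tri, doubleBracket, ev_bowtie, formEv_standardForm, onLeft, onRight]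
  simp only [map_zero, ev_zero_left, ev_zero_right, zero_add,
    sub_zero, pairEv_evD_right]
  simp only [ev_sub, ev_neg, map_sub, map_neg, pairEv_calLstar, pairEv_calRstar, neg_neg]
  rw [show -a.2 - f.2 = g.2 by linear_combination -h,
    show f.2 + g.2 = -a.2 by linear_combination h]
  ring

theorem doubleBracket_isInvariantForm : IsInvariantForm Br Bf := by
  rintro ⟨x, l⟩ ⟨y, m⟩ ⟨z, n⟩ hs
  simp only at hs
  refine forall_of_onLeft_onRight (p := fun x => tri Br _ x (y, m) (z, n) + tri Br _ _ x _ +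
    tri Br _ _ _ x = 0) (fun u v hu hv => by
      rw [tri_add₁, tri_add₂, tri_add₃]; linear_combination hu + hv)
      (fun x hx => ?_) (fun x hx => ?_) x <;>
  refine forall_of_onLeft_onRight (p := fun y => tri Br _ _ y (z, n) + tri Br _ y _ _ +
    tri Br _ y _ _ = 0) (fun u v hu hv => by
      rw [tri_add₁, tri_add₁, tri_add₂]; linear_combination hu + hv)
      (fun y hy => ?_) (fun y hy => ?_) y <;>
  refine forall_of_onLeft_onRight (p := fun z => tri Br _ _ _ z + tri Br _ _ _ z +
    tri Br _ _ z _ = 0) (fun u v hu hv => by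
      rw [tri_add₂, tri_add₃, tri_add₃]; linear_combination hu + hv)
      (fun z hz => ?_) (fun z hz => ?_) z <;>
  subst hx hy hz
  · simp only [tri_LLL, add_zero]
  · rw [tri_LLR _ _ _ hs, tri_LLR _ _ _ (by linear_combination hs),
      tri_LRL _ _ _ (by linear_combination hs)]
    ring
  · rw [tri_LRL _ _ _ hs, tri_RLL, tri_RLL]
    ring
  · rw [tri_LRR, tri_RLR _ _ _ (by linear_combination hs), tri_RRL _ _ _ (by linear_combination hs)]
    ring
  · rw [tri_RLL, tri_LRL _ _ _ (by linear_combination hs), tri_LLR _ _ _ (by linear_combination hs)]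
    ring
  · rw [tri_RLR _ _ _ hs, tri_LRR, tri_LRR]
    ring
  · rw [tri_RRL _ _ _ hs, tri_RRL _ _ _ (by linear_combination hs),
      tri_RLR _ _ _ (by linear_combination hs)]
    ring
  · simp only [tri_RRR, add_zero]

end Values

end StandardForm

/-! ### Separation of points in tensor powers -/

section Separation

variable {k : Type*} [Field k]

/-- In coordinates along a basis of W, a tensor is a finite family of vectors of V, and contraction
with a functional acts on each coordinate separately. -/
theorem eq_zero_of_separating_left {V W ι : Type*} [AddCommGroup V] [Module k V] [AddCommGroup W]
    [Module k W] (φ : ι → V →ₗ[k] k) (hφ : ∀ v, (∀ i, φ i v = 0) → v = 0) (z : V ⊗[k] W)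
    (h : ∀ i, TensorProduct.lid k W ((φ i).rTensor W z) = 0) : z = 0 := by
  let b := Module.Free.chooseBasis k W
  rw [← (TensorProduct.equivFinsuppOfBasisRight b).map_eq_zero_iff]
  refine Finsupp.ext fun j => hφ _ fun i => ?_
  have key (z : V ⊗[k] W) : φ i (TensorProduct.equivFinsuppOfBasisRight b z j) =
      b.repr (TensorProduct.lid k W ((φ i).rTensor W z)) j := by
    induction z using TensorProduct.induction_on with
    | zero => simp
    | add x y hx hy => simp only [map_add, Finsupp.add_apply, hx, hy]
    | tmul v w => simp [mul_comm]
  rw [key, h, map_zero, Finsupp.zero_apply]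

variable {Q : Type*} [AddCommGroup Q] [Module k Q] [Module k[X] Q] [IsScalarTower k k[X] Q]

/-- The value of the pairing `⟨f ⊗ g ⊗ h, z⟩_{s,t,r} ∈ k` at scalars `s`, `t`, `r`. -/
def pairEv₃ (s t r : k) (f g h : ConformalDual k Q) : Q ⊗[k] (Q ⊗[k] Q) →ₗ[k] k :=
  TensorProduct.lift ((LinearMap.mul k k).compl₁₂ (pairEv s f) (pairEv₂ t r g h))

@[simp] theorem pairEv₃_tmul (s t r : k) (f g h : ConformalDual k Q) (u : Q) (z : Q ⊗[k] Q) :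
    pairEv₃ s t r f g h (u ⊗ₜ z) = pairEv s f u * pairEv₂ t r g h z := by
  simp [pairEv₃]

section

variable [Infinite k] [Module.Free k[X] Q]

theorem eq_zero_of_pairEv₂ (z : Q ⊗[k] Q) (hz : ∀ s t f g, pairEv₂ s t f g z = 0) : z = 0 := by
  refine eq_zero_of_separating_left (fun p : k × ConformalDual k Q => pairEv p.1 p.2)
    (fun v hv => eq_zero_of_pairEv v fun s f => hv (s, f)) z fun p => ?_
  refine eq_zero_of_pairEv (k := k) _ fun t g => ?_
  refine Eq.trans ?_ (hz p.1 t p.2 g)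
  clear hz
  induction z using TensorProduct.induction_on with
  | zero => simp
  | add x y hx hy => simp only [map_add, hx, hy]
  | tmul u v => simp

theorem eq_zero_of_pairEv₃ (z : Q ⊗[k] (Q ⊗[k] Q))
    (hz : ∀ s t r f g h, pairEv₃ s t r f g h z = 0) : z = 0 := by
  refine eq_zero_of_separating_left (fun p : k × ConformalDual k Q => pairEv p.1 p.2)
    (fun v hv => eq_zero_of_pairEv v fun s f => hv (s, f)) z fun p => ?_
  refine eq_zero_of_pairEv₂ _ fun t r g h => ?_
  refine Eq.trans ?_ (hz p.1 t r p.2 g h)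
  clear hz
  induction z using TensorProduct.induction_on with
  | zero => simp
  | add x y hx hy => simp only [map_add, hx, hy]
  | tmul u v => simp

end

/-! ### Coalgebra axiom as transpose of the Leibniz identity -/

section Coalgebra

variable (s t r : k) (f g h : ConformalDual k Q)

theorem pairEv₂_comm (z : Q ⊗[k] Q) :
    pairEv₂ s t f g (TensorProduct.comm k Q Q z) = pairEv₂ t s g f z := by
  induction z using TensorProduct.induction_on with
  | zero => simp
  | add x y hx hy => simp only [map_add, hx, hy]
  | tmul u v => simp [mul_comm]

theorem pairEv₃_leftComm (z : Q ⊗[k] (Q ⊗[k] Q)) :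
    pairEv₃ s t r f g h (TensorProduct.leftComm k Q Q Q z) = pairEv₃ t s r g f h z := by
  induction z using TensorProduct.induction_on with
  | zero => simp
  | add x y hx hy => simp only [map_add, hx, hy]
  | tmul u z =>
    induction z using TensorProduct.induction_on with
    | zero => simp
    | add x y hx hy => simp only [map_add, TensorProduct.tmul_add, hx, hy]
    | tmul v w => simp [mul_left_comm]

variable [Module.Finite k[X] Q] (Δ : Q →ₗ[k] Q ⊗[k] Q) (hΔ : IsCobracket Δ)

theorem pairEv₃_lTensor (z : Q ⊗[k] Q) :
    pairEv₃ s t r f g h (Δ.lTensor Q z) =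
      pairEv₂ s (t + r) f (ev (dualBracket Δ hΔ) t g h) z := by
  induction z using TensorProduct.induction_on with
  | zero => simp
  | add x y hx hy => simp only [map_add, hx, hy]
  | tmul u v => simp [pairEv_dualBracket]

theorem pairEv₃_assoc_rTensor (z : Q ⊗[k] Q) :
    pairEv₃ s t r f g h (TensorProduct.assoc k Q Q Q (Δ.rTensor Q z)) =
      pairEv₂ (s + t) r (ev (dualBracket Δ hΔ) s f g) h z := by
  induction z using TensorProduct.induction_on with
  | zero => simp
  | add x y hx hy => simp only [map_add, hx, hy]
  | tmul u v =>
    simp only [LinearMap.rTensor_tmul, pairEv₂_tmul, pairEv_dualBracket, add_sub_cancel_left]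
    induction Δ u using TensorProduct.induction_on with
    | zero => simp
    | add x y hx hy => simp only [map_add, TensorProduct.add_tmul, hx, hy, add_mul]
    | tmul x y => simp [mul_assoc]

variable {Δ} in
theorem isLeibnizCoalgebra_of_dualBracket [Infinite k] [Module.Free k[X] Q]
    (hdual : IsLeibniz (dualBracket Δ hΔ)) : IsLeibnizCoalgebra Δ := by
  refine ⟨hΔ, fun a => ?_⟩
  rw [← sub_eq_zero]
  refine eq_zero_of_pairEv₃ _ fun s t r f g h => ?_
  -- At the value s + t + r the third functional h receives the parameter r in each of the three
  -- terms.
  have key := congrArg (fun F => pairEv (s + t + r) F a) (hdual s t f g h)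
  simp only [map_add, LinearMap.add_apply, pairEv_dualBracket Δ hΔ] at key
  rw [show s + t + r - s = t + r by ring, show s + t + r - (s + t) = r by ring,
    show s + t + r - t = s + r by ring] at key
  rw [map_sub, map_add, pairEv₃_leftComm, pairEv₃_lTensor _ _ _ _ _ _ Δ hΔ,
    pairEv₃_lTensor _ _ _ _ _ _ Δ hΔ, pairEv₃_assoc_rTensor _ _ _ _ _ _ Δ hΔ, key, sub_self]

end Coalgebra

/-! ### Transposes of the operators in the compatibility conditions -/

section Actions

variable (s t c : k) (f g : ConformalDual k Q) (T : Module.End k (Q ⊗[k] Q))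

theorem pairEv₂_derLeft (z : Q ⊗[k] Q) :
    pairEv₂ s t f g (derLeft k Q z) = s * pairEv₂ s t f g z := by
  induction z using TensorProduct.induction_on with
  | zero => simp
  | add x y hx hy => simp only [map_add, hx, hy, mul_add]
  | tmul u v => simp [derLeft, pairEv_X_smul_right, mul_assoc]

theorem pairEv₂_derTensor (z : Q ⊗[k] Q) :
    pairEv₂ s t f g (derTensor k Q z) = (s + t) * pairEv₂ s t f g z := by
  induction z using TensorProduct.induction_on with
  | zero => simp
  | add x y hx hy => simp only [map_add, hx, hy, mul_add]
  | tmul u v =>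
    simp only [derTensor, LinearMap.add_apply, LinearMap.rTensor_tmul, LinearMap.lTensor_tmul,
      der_apply, map_add, pairEv₂_tmul, pairEv_X_smul_right]
    ring

variable [Module.Finite k[X] Q] (l : ConformalBilin k Q Q Q) (a : Q)

variable {s t c f g T} in
theorem pairEv₂_pow (hT : ∀ z, pairEv₂ s t f g (T z) = c * pairEv₂ s t f g z) (n : ℕ)
    (z : Q ⊗[k] Q) : pairEv₂ s t f g ((T ^ n) z) = c ^ n * pairEv₂ s t f g z := by
  induction n with
  | zero => simp
  | succ n ih => rw [pow_succ', Module.End.mul_apply, hT, ih, pow_succ']; ring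

/-- Under a pairing where T acts by c, the operator is l(a) at λ = c on the first leg, and its
transpose is the dual action on f. The sign and the shift from s to s + c are those in the
definition of the dual action. -/
theorem pairEv₂_actLeft (hT : ∀ z, pairEv₂ s t f g (T z) = c * pairEv₂ s t f g z)
    (z : Q ⊗[k] Q) : pairEv₂ s t f g (actLeft (l.1 a) T z) =
      -pairEv₂ (s + c) t (ev (dualAction l) c a f) g z := by
  induction z using TensorProduct.induction_on with
  | zero => simp
  | add x y hx hy => simp only [map_add, hx, hy, neg_add]
  | tmul u v =>
    rw [pairEv₂_tmul, pairEv_dualAction, add_sub_cancel_right, neg_mul, neg_neg, ev]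
    simp only [actLeft, TensorProduct.lift.tmul, LinearMap.comp_apply]
    induction l.1 a u using PolynomialModule.induction_linear with
    | zero => simp
    | add p q hp hq =>
      rw [map_add, map_add, LinearMap.add_apply, map_add, hp, hq, map_add, map_add, add_mul]
    | single n w =>
      simp [pairEv₂_pow hT, mul_assoc]

theorem pairEv₂_actRight (hT : ∀ z, pairEv₂ s t f g (T z) = c * pairEv₂ s t f g z)
    (z : Q ⊗[k] Q) : pairEv₂ s t f g (actRight (l.1 a) T z) =
      -pairEv₂ s (t + c) f (ev (dualAction l) c a g) z := by
  induction z using TensorProduct.induction_on with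
  | zero => simp
  | add x y hx hy => simp only [map_add, hx, hy, neg_add]
  | tmul u v =>
    rw [pairEv₂_tmul, pairEv_dualAction, add_sub_cancel_right, mul_neg, neg_neg, ev]
    simp only [actRight, TensorProduct.lift.tmul, LinearMap.comp_apply, LinearMap.flip_apply]
    induction l.1 a v using PolynomialModule.induction_linear with
    | zero => simp
    | add p q hp hq =>
      rw [map_add, map_add, LinearMap.add_apply, map_add, hp, hq, map_add, map_add, mul_add]
    | single n w =>
      simp [pairEv₂_pow hT, mul_left_comm]

end Actions

end Separation

/-! ### The bialgebra conditions as mixed Leibniz defects -/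

section Compatibility

variable {k : Type*} [Field k]
variable {Q : Type*} [AddCommGroup Q] [Module k Q] [Module k[X] Q] [IsScalarTower k k[X] Q]
variable [Module.Finite k[X] Q] [Module.Free k[X] Q]
variable (br : ConformalBilin k Q Q Q) {Δ : Q →ₗ[k] Q ⊗[k] Q} (hΔ : IsCobracket Δ)

local notation "Br" => doubleBracket br (dualBracket Δ hΔ)
local notation "Bf" => standardForm k Q
local notation "iL" => onLeft (ConformalDual k Q)
local notation "iR" => onRight Q

/-- A bracket of an element of Q with one of the dual has components in both summands. The
contribution of its Q-component is rewritten as the form of a functional against all of w, so that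
when w is a bracket the result is again a value of `tri`. `tri_L_R_any` does this for the last slot.
-/
theorem tri_L_any_R (b : Q × k) (w : (Q × ConformalDual k Q) × k) (g : ConformalDual k Q × k)
    (h : b.2 + w.2 + g.2 = 0) :
    tri Br Bf (iL b) w (iR g) = tri Br Bf (iL b) (iR (w.1.2, w.2)) (iR g) -
      formEv Bf (b.2 + g.2) (0, ev (Rstar br) b.2 b.1 g.1) w.1 := by
  have hw : w = ((w.1.1, 0) + (0, w.1.2), w.2) := by simp
  conv_lhs => rw [hw, tri_add₂]
  have e := tri_LLR (br := br) (br' := dualBracket Δ hΔ) b (w.1.1, w.2) g h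
  simp only [onLeft, onRight] at e ⊢
  rw [e, formEv_standardForm]
  simp only [map_zero, sub_zero, pairEv_Rstar, add_sub_cancel_left]
  rw [show -(b.2 + g.2) = w.2 by linear_combination -h]
  ring

theorem tri_L_R_any (b : Q × k) (f : ConformalDual k Q × k) (w : (Q × ConformalDual k Q) × k)
    (h : b.2 + f.2 + w.2 = 0) :
    tri Br Bf (iL b) (iR f) w = tri Br Bf (iL b) (iR f) (iR (w.1.2, w.2)) +
      formEv Bf (b.2 + f.2)
        (0, ev (Lstar br) b.2 b.1 f.1 + ev (Rstar br) b.2 b.1 f.1) w.1 := by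
  have hw : w = ((w.1.1, 0) + (0, w.1.2), w.2) := by simp
  conv_lhs => rw [hw, tri_add₃]
  have e := tri_LRL (br := br) (br' := dualBracket Δ hΔ) b (w.1.1, w.2) f h
  simp only [onLeft, onRight] at e ⊢
  rw [e, formEv_standardForm]
  simp only [map_zero, sub_zero, map_add, LinearMap.add_apply, pairEv_Rstar, pairEv_Lstar,
    add_sub_cancel_left]
  rw [show -(b.2 + f.2) = w.2 by linear_combination -h]
  ring

theorem brk_LR_right (a : Q × k) (f : ConformalDual k Q × k) :
    (brk Br (iL a) (iR f)).1.2 = ev (Lstar br) a.2 a.1 f.1 := by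
  simp [brk, doubleBracket, ev_bowtie, onLeft, onRight]

theorem brk_RL_right (a : Q × k) (f : ConformalDual k Q × k) :
    (brk Br (iR f) (iL a)).1.2 = evD (-Lstar br - Rstar br) (-f.2) a.1 f.1 := by
  simp [brk, doubleBracket, ev_bowtie, onLeft, onRight]

theorem tri_LRR_dualBracket (b : Q × k) (f g : ConformalDual k Q × k) (h : b.2 + f.2 + g.2 = 0) :
    tri Br Bf (iL b) (iR f) (iR g) = -pairEv₂ f.2 g.2 f.1 g.1 (Δ b.1) := by
  rw [tri_LRR, pairEv_dualBracket, show -b.2 - f.2 = g.2 by linear_combination -h]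

theorem tri_RLR_dualBracket (f g : ConformalDual k Q × k) (a : Q × k) (h : f.2 + a.2 + g.2 = 0) :
    tri Br Bf (iR f) (iL a) (iR g) =
      pairEv₂ g.2 f.2 g.1 f.1 (Δ a.1) + pairEv₂ f.2 g.2 f.1 g.1 (Δ a.1) := by
  rw [tri_RLR _ _ _ h, pairEv_dualBracket, pairEv_dualBracket,
    show -a.2 - f.2 = g.2 by linear_combination -h, show -a.2 - g.2 = f.2 by linear_combination -h]

theorem tri_RRL_dualBracket (f g : ConformalDual k Q × k) (a : Q × k) (h : f.2 + g.2 + a.2 = 0) :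
    tri Br Bf (iR f) (iR g) (iL a) = -pairEv₂ g.2 f.2 g.1 f.1 (Δ a.1) := by
  rw [tri_RRL _ _ _ h, pairEv_dualBracket, show -a.2 - g.2 = f.2 by linear_combination -h]

theorem tri_L_brk_LR_R (a b : Q × k) (f g : ConformalDual k Q × k)
    (h : b.2 + a.2 + f.2 + g.2 = 0) :
    tri Br Bf (iL b) (brk Br (iL a) (iR f)) (iR g) =
      -pairEv₂ (a.2 + f.2) g.2 (ev (Lstar br) a.2 a.1 f.1) g.1 (Δ b.1) -
      (pairEv₂ f.2 (b.2 + g.2) f.1 (ev (Rstar br) b.2 b.1 g.1) (Δ a.1) +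
        pairEv₂ (b.2 + g.2) f.2 (ev (Rstar br) b.2 b.1 g.1) f.1 (Δ a.1)) := by
  rw [tri_L_any_R br hΔ _ _ _ (by rw [← h]; simp only [brk, onLeft_snd, onRight_snd]; ring),
    brk_LR_right, tri_LRR_dualBracket br hΔ _ _ _
      (by rw [← h]; simp only [brk, onLeft_snd, onRight_snd]; ring)]
  -- The correction term of `tri_L_any_R` is the trilinear function of R*(b)g, a and f.
  have e := tri_RLR_dualBracket br hΔ (ev (Rstar br) b.2 b.1 g.1, b.2 + g.2) f a
    (by rw [← h]; ring)
  rw [tri_eq_formEv_brk] at e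
  simp only [onRight] at e ⊢
  rw [e]
  rfl

/-- Once the dual actions are transposed, the right-hand side is the second compatibility condition
paired with f and g. -/
theorem jac_LLRR (a b : Q × k) (f g : ConformalDual k Q × k) (h : b.2 + a.2 + f.2 + g.2 = 0) :
    jac Br Bf (iL b) (iL a) (iR f) (iR g) =
      pairEv₂ f.2 g.2 f.1 g.1 (Δ (ev br a.2 a.1 b.1)) +
      pairEv₂ (a.2 + f.2) g.2 (ev (Lstar br) a.2 a.1 f.1) g.1 (Δ b.1) +
      pairEv₂ f.2 (a.2 + g.2) f.1 (ev (Lstar br) a.2 a.1 g.1) (Δ b.1) +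
      (pairEv₂ f.2 (b.2 + g.2) f.1 (ev (Rstar br) b.2 b.1 g.1) (Δ a.1) +
        pairEv₂ (b.2 + g.2) f.2 (ev (Rstar br) b.2 b.1 g.1) f.1 (Δ a.1)) -
      (pairEv₂ g.2 (b.2 + f.2) g.1
          (ev (Lstar br) b.2 b.1 f.1 + ev (Rstar br) b.2 b.1 f.1) (Δ a.1) +
        pairEv₂ (b.2 + f.2) g.2
          (ev (Lstar br) b.2 b.1 f.1 + ev (Rstar br) b.2 b.1 f.1) g.1 (Δ a.1)) := by
  have e₁ : tri Br Bf (iL b) (iL a) (brk Br (iR f) (iR g)) =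
      pairEv₂ f.2 g.2 f.1 g.1 (Δ (ev br a.2 a.1 b.1)) := by
    rw [(doubleBracket_extends _ _).brk_onRight,
      tri_LLR _ _ _ (by rw [← h]; simp only [brk]; ring)]
    simp only [brk]
    rw [pairEv_dualBracket, add_sub_cancel_left]
  have e₂ := tri_RLR_dualBracket br hΔ
    (ev (Lstar br) b.2 b.1 f.1 + ev (Rstar br) b.2 b.1 f.1, b.2 + f.2) g a (by rw [← h]; ring)
  rw [tri_eq_formEv_brk] at e₂
  rw [jac, e₁, tri_L_brk_LR_R br hΔ a b f g h,
    tri_L_R_any br hΔ _ _ _ (by rw [← h]; simp only [brk, onLeft_snd, onRight_snd]; ring),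
    brk_LR_right, tri_LRR_dualBracket br hΔ _ _ _
      (by rw [← h]; simp only [brk, onLeft_snd, onRight_snd]; ring)]
  simp only [onRight, brk, onLeft] at e₂ ⊢
  rw [e₂]
  ring

theorem tri_L_brk_RL_R (a b : Q × k) (f g : ConformalDual k Q × k)
    (h : b.2 + a.2 + f.2 + g.2 = 0) :
    tri Br Bf (iL b) (brk Br (iR f) (iL a)) (iR g) =
      pairEv₂ (a.2 + f.2) g.2 (ev (Lstar br) a.2 a.1 f.1) g.1 (Δ b.1) +
      pairEv₂ (a.2 + f.2) g.2 (ev (Rstar br) a.2 a.1 f.1) g.1 (Δ b.1) +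
      pairEv₂ f.2 (b.2 + g.2) f.1 (ev (Rstar br) b.2 b.1 g.1) (Δ a.1) := by
  have e₁ : pairEv (-b.2) (ev (dualBracket Δ hΔ) (f.2 + a.2)
      (evD (-Lstar br - Rstar br) (-f.2) a.1 f.1) g.1) b.1 =
      pairEv (-b.2) (ev (dualBracket Δ hΔ) (f.2 + a.2)
        (ev (-Lstar br - Rstar br) a.2 a.1 f.1) g.1) b.1 := by
    -- For the functional w ↦ ⟨[w,g], b⟩ with bracket parameter f.2 + a.2, ∂ acts by -(f.2 + a.2),
    -- so the parameter -f.2-∂ becomes a.2.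
    have := map_evD (-Lstar br - Rstar br) (-f.2)
      ((pairEv (-b.2)).flip b.1 ∘ₗ (evLin (dualBracket Δ hΔ) (f.2 + a.2)).flip g.1)
      (-(f.2 + a.2)) (fun w => by simp [evLin_apply, ev_X_smul_left]; ring) a.1 f.1
    simpa [evLin_apply] using this
  have e₂ := tri_RRL_dualBracket br hΔ (ev (Rstar br) b.2 b.1 g.1, b.2 + g.2) f a
    (by rw [← h]; ring)
  rw [tri_eq_formEv_brk] at e₂
  rw [tri_L_any_R br hΔ _ _ _ (by rw [← h]; simp only [brk, onLeft_snd, onRight_snd]; ring),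
    brk_RL_right, tri_LRR]
  simp only [onRight, brk, onLeft] at e₂ ⊢
  rw [e₁, e₂, ev_sub, ev_neg, ev_sub_left, ev_neg_left]
  simp only [map_sub, map_neg, LinearMap.sub_apply, LinearMap.neg_apply, pairEv_dualBracket]
  rw [add_comm f.2 a.2, show -b.2 - (a.2 + f.2) = g.2 by linear_combination -h]
  ring

/-- The terms with [a,[f,g]] and [f,[a,g]] cancel, and what remains is minus the pairing of b with
[[a,f] + [f,a], g]. The parts involving L* cancel as well. -/
theorem jac_LLRR_add_jac_LRLR (a b : Q × k) (f g : ConformalDual k Q × k)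
    (h : b.2 + a.2 + f.2 + g.2 = 0) :
    jac Br Bf (iL b) (iL a) (iR f) (iR g) + jac Br Bf (iL b) (iR f) (iL a) (iR g) =
      pairEv₂ (b.2 + g.2) f.2 (ev (Rstar br) b.2 b.1 g.1) f.1 (Δ a.1) -
      pairEv₂ (a.2 + f.2) g.2 (ev (Rstar br) a.2 a.1 f.1) g.1 (Δ b.1) := by
  rw [jac, jac, tri_L_brk_LR_R br hΔ a b f g h, tri_L_brk_RL_R br hΔ a b f g h]
  ring

theorem compat₁_iff [Infinite k] :
    (∀ (s : k) (a b : Q), actLeft ((rightMul br).1 a) (s • 1 - derLeft k Q) (Δ b) =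
      TensorProduct.comm k Q Q (actLeft ((rightMul br).1 b) (-s • 1 - derLeft k Q) (Δ a))) ↔
    ∀ (a b : Q × k) (f g : ConformalDual k Q × k), b.2 + a.2 + f.2 + g.2 = 0 →
      jac Br Bf (iL b) (iL a) (iR f) (iR g) + jac Br Bf (iL b) (iR f) (iL a) (iR g) = 0 := by
  have key (s p q : k) (a b : Q) (f g : ConformalDual k Q) :
      pairEv₂ p q f g (actLeft ((rightMul br).1 a) (s • 1 - derLeft k Q) (Δ b) -
        TensorProduct.comm k Q Q (actLeft ((rightMul br).1 b) (-s • 1 - derLeft k Q) (Δ a))) =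
      pairEv₂ (-s) p (ev (Rstar br) (-s - q) b g) f (Δ a) -
        pairEv₂ s q (ev (Rstar br) (s - p) a f) g (Δ b) := by
    rw [map_sub, pairEv₂_comm,
      pairEv₂_actLeft p q (s - p) f g _ (rightMul br) a (fun z => by
        simp [pairEv₂_derLeft, sub_mul]),
      pairEv₂_actLeft q p (-s - q) g f _ (rightMul br) b (fun z => by
        simp [pairEv₂_derLeft, sub_mul]), add_sub_cancel, add_sub_cancel]
    simp only [Rstar]
    ring
  constructor
  · rintro h ⟨a, s⟩ ⟨b, m⟩ ⟨f, p⟩ ⟨g, q⟩ hs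
    simp only at hs
    rw [jac_LLRR_add_jac_LRLR br hΔ _ _ _ _ hs]
    have e := key (s + p) p q a b f g
    rw [sub_eq_zero.mpr (h (s + p) a b), map_zero, show -(s + p) - q = m by linear_combination -hs,
      add_sub_cancel_right, show -(s + p) = m + q by linear_combination -hs] at e
    exact e.symm
  · intro h s a b
    rw [← sub_eq_zero]
    refine eq_zero_of_pairEv₂ _ fun p q f g => ?_
    have e := h (a, s - p) (b, -s - q) (f, p) (g, q) (by ring)
    rw [jac_LLRR_add_jac_LRLR br hΔ _ _ _ _ (by ring)] at e
    simp only [sub_add_cancel] at e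
    rw [key, e]

theorem compat₂_iff [Infinite k] :
    (∀ (s : k) (a b : Q), Δ (ev br s a b) =
      (actRight ((rightMul br).1 b) (-s • 1 - derTensor k Q) -
        actLeft (br.1 b) (-s • 1 - derTensor k Q) -
        actLeft ((rightMul br).1 b) (-s • 1 - derTensor k Q))
        (TensorProduct.comm k Q Q (Δ a) + Δ a) +
      (actRight (br.1 a) (s • 1) + actLeft (br.1 a) (s • 1)) (Δ b)) ↔
    ∀ (a b : Q × k) (f g : ConformalDual k Q × k), b.2 + a.2 + f.2 + g.2 = 0 →
      jac Br Bf (iL b) (iL a) (iR f) (iR g) = 0 := by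
  have key (s m p q : k) (hs : m + s + p + q = 0) (a b : Q) (f g : ConformalDual k Q) :
      pairEv₂ p q f g (Δ (ev br s a b) -
        ((actRight ((rightMul br).1 b) (-s • 1 - derTensor k Q) -
        actLeft (br.1 b) (-s • 1 - derTensor k Q) -
        actLeft ((rightMul br).1 b) (-s • 1 - derTensor k Q))
        (TensorProduct.comm k Q Q (Δ a) + Δ a) +
      (actRight (br.1 a) (s • 1) + actLeft (br.1 a) (s • 1)) (Δ b))) =
      jac Br Bf (iL (b, m)) (iL (a, s)) (iR (f, p)) (iR (g, q)) := by
    have hT (z : Q ⊗[k] Q) : pairEv₂ p q f g ((-s • (1 : Module.End k (Q ⊗[k] Q)) -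
        derTensor k Q) z) = m * pairEv₂ p q f g z := by
      rw [show m = -s - (p + q) by linear_combination hs]
      simp [pairEv₂_derTensor, sub_mul]
    have hT' (z : Q ⊗[k] Q) : pairEv₂ p q f g ((s • (1 : Module.End k (Q ⊗[k] Q))) z) =
        s * pairEv₂ p q f g z := by simp
    rw [jac_LLRR br hΔ _ _ _ _ hs]
    simp only [LinearMap.add_apply, LinearMap.sub_apply, map_add, map_sub,
      pairEv₂_actLeft _ _ _ _ _ _ _ _ hT, pairEv₂_actRight _ _ _ _ _ _ _ _ hT,
      pairEv₂_actLeft _ _ _ _ _ _ _ _ hT', pairEv₂_actRight _ _ _ _ _ _ _ _ hT', pairEv₂_comm,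
      Lstar, Rstar]
    have hl (s t : k) (f f' g : ConformalDual k Q) (z : Q ⊗[k] Q) :
        pairEv₂ s t (f + f') g z = pairEv₂ s t f g z + pairEv₂ s t f' g z := by
      induction z using TensorProduct.induction_on with
      | zero => simp
      | add x y hx hy => simp only [map_add, hx, hy]; ring
      | tmul u v => simp [add_mul]
    have hr (s t : k) (f g g' : ConformalDual k Q) (z : Q ⊗[k] Q) :
        pairEv₂ s t f (g + g') z = pairEv₂ s t f g z + pairEv₂ s t f g' z := by
      rw [← pairEv₂_comm, hl, pairEv₂_comm, pairEv₂_comm]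
    simp only [hl, hr]
    rw [add_comm p m, add_comm q m, add_comm p s, add_comm q s]
    ring
  constructor
  · rintro h ⟨a, s⟩ ⟨b, m⟩ ⟨f, p⟩ ⟨g, q⟩ hs
    rw [← key s m p q hs, sub_eq_zero.mpr (h s a b), map_zero]
  · intro h s a b
    rw [← sub_eq_zero]
    refine eq_zero_of_pairEv₂ _ fun p q f g => ?_
    rw [key s (-s - p - q) p q (by ring)]
    exact h _ _ _ _ (by ring)

end Compatibility

section Equivalence

variable {k : Type*} [Field k] [Infinite k]
variable {Q : Type*} [AddCommGroup Q] [Module k Q] [Module k[X] Q] [IsScalarTower k k[X] Q]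
variable [Module.Finite k[X] Q] [Module.Free k[X] Q]
variable {br : ConformalBilin k Q Q Q}

/-- The double of two brackets is a Leibniz conformal algebra if and only if some extension of the
brackets turns the standard form into that of a conformal Manin triple. -/
theorem isLeibniz_doubleBracket_iff
    {br' : ConformalBilin k (ConformalDual k Q) (ConformalDual k Q) (ConformalDual k Q)} :
    IsLeibniz (doubleBracket br br') ↔
      ∃ brE, ExtendsBrackets brE br br' ∧ IsConformalManinTriple brE (standardForm k Q)
        (LinearMap.range (LinearMap.inl k[X] Q (ConformalDual k Q)))
        (LinearMap.range (LinearMap.inr k[X] Q (ConformalDual k Q))) := by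
  constructor
  · intro h
    have hext := doubleBracket_extends br br'
    refine ⟨doubleBracket br br', hext, ?_⟩
    constructor
    · exact h
    · infer_instance
    · infer_instance
    · infer_instance
    · exact standardForm_nondegenerate
    · exact standardForm_skew
    · exact (isInvariantForm_iff standardForm_isSkewForm).mp doubleBracket_isInvariantForm
    · rintro _ ⟨a, rfl⟩ _ ⟨b, rfl⟩ n
      refine ⟨(br.1 a b).coeff n, ?_⟩
      simp only [LinearMap.inl_apply, hext.1]
      simp [PolynomialModule.map]
    · rintro _ ⟨a, rfl⟩ _ ⟨b, rfl⟩ n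
      refine ⟨(br'.1 a b).coeff n, ?_⟩
      simp only [LinearMap.inr_apply, hext.2]
      simp [PolynomialModule.map]
    · exact LinearMap.isCompl_range_inl_inr
    · rintro _ ⟨a, rfl⟩ _ ⟨b, rfl⟩
      simp [standardForm]
    · rintro _ ⟨a, rfl⟩ _ ⟨b, rfl⟩
      simp [standardForm]
  · rintro ⟨brE, hext, hM⟩ s t a b c
    have hev := hext.ev_eq (doubleBracket_extends br br')
      ((isInvariantForm_iff standardForm_isSkewForm).mpr hM.invariant) doubleBracket_isInvariantForm
    have := hM.leibniz s t a b c
    simpa only [hev] using this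

/-- The double of a Leibniz conformal algebra and the dual of a cobracket is a Leibniz conformal
algebra if and only if the cobracket defines a bialgebra. -/
theorem isLeibniz_doubleBracket_iff_bialgebra (hbr : IsLeibniz br) {Δ : Q →ₗ[k] Q ⊗[k] Q}
    (hΔ : IsCobracket Δ) (hdual : IsLeibniz (dualBracket Δ hΔ)) :
    IsLeibniz (doubleBracket br (dualBracket Δ hΔ)) ↔ IsLeibnizBialgebra br Δ := by
  rw [isLeibniz_iff_jac (B := standardForm k Q) standardForm_separatingRight]
  constructor
  · intro h
    refine ⟨hbr, isLeibnizCoalgebra_of_dualBracket hΔ hdual, (compat₁_iff br hΔ).mpr ?_,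
      (compat₂_iff br hΔ).mpr ?_⟩
    · intro a b f g hs
      rw [h _ _ _ _ hs, h _ _ _ _ (by
        rw [← hs]; simp only [onLeft_snd, onRight_snd]; ring), add_zero]
    · intro a b f g hs
      exact h _ _ _ _ hs
  · intro h
    have h₁ := (compat₁_iff br hΔ).mp h.compat₁
    have h₂ := (compat₂_iff br hΔ).mp h.compat₂
    have hext := doubleBracket_extends br (dualBracket Δ hΔ)
    refine jac_eq_zero_of_onLeft_onRight standardForm_isSkewForm doubleBracket_isInvariantForm
      ?_ ?_ ?_ ?_ (fun d a b c hs => h₂ a d b c hs) ?_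
    · intro d a b c _
      simp only [jac, hext.brk_onLeft, tri_LLL, sub_zero]
    · intro d a b c _
      simp only [jac, hext.brk_onRight, tri_RRR, sub_zero]
    · intro d a b c _
      simp only [jac, hext.brk_onLeft, tri_RLL]
      simp only [brk, hbr a.2 b.2 a.1 b.1 c.1, map_add]
      ring
    · intro d a b c _
      simp only [jac, hext.brk_onRight, tri_LRR]
      simp only [brk, hdual a.2 b.2 a.1 b.1 c.1, map_add, LinearMap.add_apply]
      ring
    · intro d b a c hs
      have hs' : d.2 + b.2 + a.2 + c.2 = 0 := by rw [← hs]; ring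
      have := h₁ b d a c hs'
      rwa [h₂ b d a c hs', zero_add] at this

end Equivalence

end LeibnizConformal

end

theorem corollary3p7 {k : Type*} [Field k] [CharZero k]
    {Q : Type*} [AddCommGroup Q] [Module k Q] [Module k[X] Q] [IsScalarTower k k[X] Q]
    [Module.Finite k[X] Q] [Module.Free k[X] Q]
    (br : LeibnizConformal.ConformalBilin k Q Q Q) (hbr : LeibnizConformal.IsLeibniz br)
    (Δ : Q →ₗ[k] Q ⊗[k] Q) (hΔ : LeibnizConformal.IsCobracket Δ)
    (hdual : LeibnizConformal.IsLeibniz (LeibnizConformal.dualBracket Δ hΔ)) :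
    List.TFAE
      [ LeibnizConformal.IsMatchedPair br (LeibnizConformal.dualBracket Δ hΔ)
          (LeibnizConformal.Lstar br)
          (-LeibnizConformal.Lstar br - LeibnizConformal.Rstar br)
          (LeibnizConformal.calLstar (LeibnizConformal.dualBracket Δ hΔ))
          (-LeibnizConformal.calLstar (LeibnizConformal.dualBracket Δ hΔ) -
            LeibnizConformal.calRstar (LeibnizConformal.dualBracket Δ hΔ)),
        ∃ brE : LeibnizConformal.ConformalBilin k (Q × LeibnizConformal.ConformalDual k Q)
            (Q × LeibnizConformal.ConformalDual k Q) (Q × LeibnizConformal.ConformalDual k Q),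
          LeibnizConformal.ExtendsBrackets brE br (LeibnizConformal.dualBracket Δ hΔ) ∧
          LeibnizConformal.IsConformalManinTriple brE (LeibnizConformal.standardForm k Q)
            (LinearMap.range (LinearMap.inl k[X] Q (LeibnizConformal.ConformalDual k Q)))
            (LinearMap.range (LinearMap.inr k[X] Q (LeibnizConformal.ConformalDual k Q))),
        LeibnizConformal.IsLeibnizBialgebra br Δ ] := by
  have h₁ := LeibnizConformal.isLeibniz_doubleBracket_iff (br := br)
    (br' := LeibnizConformal.dualBracket Δ hΔ)
  have h₂ := LeibnizConformal.isLeibniz_doubleBracket_iff_bialgebra hbr hΔ hdual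
  tfae_have 1 ↔ 2 := LeibnizConformal.isMatchedPair_iff.trans h₁
  tfae_have 2 ↔ 3 := h₁.symm.trans h₂
  tfae_finish
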